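/- **Theorem 4.3 (Diffused interface approximation of dry soap films).** Let $n\ge 1$, and let $W\in C^{2,1}[0,1]$ satisfy $W(0)=W(1)=0$, $W>0$ on $(0,1)$, $W''(0),W''(1)>0$ and $\int_0^1\sqrt{W}=1$. Set $\Phi(t)=\int_0^t\sqrt{W(s)}\,ds$ and $V(t)=\Phi(t)^{(n+1)/n}$ for $t\in[0,1]$. For $\Omega\subset\mathbb{R}^{n+1}$ open, $\varepsilon>0$ and $u\in W^{1,2}_{\rm loc}(\Omega)$ with values in $[0,1]$ set $$\mathcal{AC}_\varepsilon(u;\Omega)=\int_\Omega \varepsilon\,|\nabla u|^2+\frac{W(u)}{\varepsilon}\,dx\,,\qquad \mathcal{V}(u;\Omega)=\int_\Omega V(u)\,dx\,.$$ Let $\mathbf{W}\subset\mathbb{R}^{n+1}$ be compact and such that $\Omega=\mathbb{R}^{n+1}\setminus\mathbf{W}$ has smooth boundary. Let $\mathcal{C}$ be a spanning class for $\mathbf{W}$, that is, a family of smooth embeddings $\gamma:\mathbb{S}^1\to\Omega$ such that $F(\cdot,1)\in\mathcal{C}$ whenever $F\in C^\infty(\mathbb{S}^1\times[0,1];\Omega)$,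 $F(\cdot,t)$ is a smooth embedding of $\mathbb{S}^1$ into $\Omega$ for every $t\in[0,1]$, and $F(\cdot,0)\in\mathcal{C}$. A relatively closed set $S\subset\Omega$ is called $\mathcal{C}$-spanning $\mathbf{W}$ if $S\cap\gamma(\mathbb{S}^1)\neq\varnothing$ for every $\gamma\in\mathcal{C}$. Let $K\subset\Omega$ be relatively closed in $\Omega$, bounded, $\mathcal{C}$-spanning $\mathbf{W}$ and $\mathcal{H}^n$-rectifiable (that is, $\mathcal{H}^n(K)<\infty$ and, up to an $\mathcal{H}^n$-null set, $K$ is covered by countably many Lipschitz images of $\mathbb{R}^n$), and suppose that there are $c>0$ and $r_0>0$ with $$\mathcal{H}^n(K\cap B_r(x))\ge c\,r^n\qquad\text{for every }x\in\overline{K}\text{ and }0<r<r_0\,.$$ If $\nu:(0,1)\to(0,\infty)$ and $\delta:(0,1)\to(1/2,1)$ are such that, as $\varepsilon\to0^+$, $$\nu(\varepsilon)\to 0\,,\qquad \delta(\varepsilon)\to\delta_0\in[1/2,1]\,,\qquad \frac{\varepsilon}{\nu(\varepsilon)}\to 0\,,$$ then there are $\varepsilon_j\in(0,1)$ with $\varepsilon_j\to0$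 as $j\to\infty$, and, for every $j$ and every $\varepsilon\in(0,\varepsilon_j)$, a Lipschitz function $u^j_\varepsilon:\Omega\to[0,1]$ in $W^{1,2}_{\rm loc}(\Omega)$, such that for every $j$ and every $\varepsilon\in(0,\varepsilon_j)$ $$\{u^j_\varepsilon\ge\delta(\varepsilon)\}\ \text{is $\mathcal{C}$-spanning $\mathbf{W}$}\,,\qquad \mathcal{V}(u^j_\varepsilon;\Omega)=\nu(\varepsilon)\,,$$ and $$\limsup_{j\to\infty}\ \sup_{0<\varepsilon<\varepsilon_j}\ \frac{\mathcal{AC}_\varepsilon(u^j_\varepsilon;\Omega)}{2}\ \le\ 2\,\Phi(\delta_0)\,\mathcal{H}^n(K)\,.$$ -/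

import Mathlib

open Set Filter Topology MeasureTheory Manifold
open scoped ContDiff ENNReal NNReal

noncomputable section

namespace SoapFilm

/-- The ambient Euclidean space `ℝ^(n+1)`. -/
abbrev Space (n : ℕ) : Type := EuclideanSpace ℝ (Fin (n + 1))

/-! ### Homotopic spanning -/

/-- A smooth isotopy of embedded circles in `Ω`: a map of class `C^∞` on `𝕊¹ × [0,1]`, with values
in `Ω`, such that every time slice is a smooth embedding of the circle. -/
structure IsLoopIsotopy {n : ℕ} (Ω : Set (Space n)) (F : Circle × ℝ → Space n) : Prop where
  smooth : ContMDiffOn ((𝓡 1).prod 𝓘(ℝ, ℝ)) 𝓘(ℝ, Space n) ∞ F (univ ×ˢ Icc (0 : ℝ) 1)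
  mem : ∀ s : Circle, ∀ t ∈ Icc (0 : ℝ) 1, F (s, t) ∈ Ω
  embedding : ∀ t ∈ Icc (0 : ℝ) 1,
    IsSmoothEmbedding (𝓡 1) 𝓘(ℝ, Space n) ∞ (fun s : Circle => F (s, t))

/-- `C` is a spanning class for the complement of `Ω`: a family of smooth embeddings of the circle
into `Ω` which is closed under smooth isotopies of embeddings in `Ω`. -/
structure IsSpanningClass {n : ℕ} (Ω : Set (Space n)) (C : Set (Circle → Space n)) : Prop where
  embedding : ∀ γ ∈ C, IsSmoothEmbedding (𝓡 1) 𝓘(ℝ, Space n) ∞ γ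
  mem : ∀ γ ∈ C, ∀ s, γ s ∈ Ω
  isotopy : ∀ F : Circle × ℝ → Space n, IsLoopIsotopy Ω F →
    (fun s => F (s, 0)) ∈ C → (fun s => F (s, 1)) ∈ C

/-- `S` is a subset of `Ω` that is closed in the relative topology of `Ω`. -/
def IsRelClosed {n : ℕ} (Ω S : Set (Space n)) : Prop :=
  ∃ F : Set (Space n), IsClosed F ∧ S = F ∩ Ω

/-- The relatively closed set `S ⊆ Ω` is `C`-spanning: it meets every curve of the class. -/
def IsSpanning {n : ℕ} (Ω : Set (Space n)) (C : Set (Circle → Space n)) (S : Set (Space n)) :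
    Prop :=
  IsRelClosed Ω S ∧ ∀ γ ∈ C, (S ∩ range γ).Nonempty

/-! ### Smooth boundaries and rectifiable sets -/

/-- The open set `Ω` has smooth boundary: near each boundary point, `Ω` is a sublevel set
of a smooth function with nonvanishing differential. -/
def HasSmoothBoundary {n : ℕ} (Ω : Set (Space n)) : Prop :=
  ∀ x ∈ frontier Ω, ∃ U ∈ 𝓝 x, ∃ f : Space n → ℝ,
    ContDiff ℝ ∞ f ∧ fderiv ℝ f x ≠ 0 ∧ Ω ∩ U = {y | f y < 0} ∩ U

/-- `K` is `ℋⁿ`-rectifiable: it has finite `ℋⁿ`-measure and is covered, up to an `ℋⁿ`-null set,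
by countably many Lipschitz images of `ℝⁿ`. Here `μHE[n]` is the Hausdorff measure with the
Euclidean normalization, so that it agrees with area. -/
structure IsRectifiable (n : ℕ) (K : Set (Space n)) : Prop where
  finite : μHE[n] K < ⊤
  cover : ∃ f : ℕ → EuclideanSpace ℝ (Fin n) → Space n,
    (∀ i, ∃ L : ℝ≥0, LipschitzWith L (f i)) ∧ μHE[n] (K \ ⋃ i, range (f i)) = 0

/-! ### The double-well potential and the associated potentials -/

/-- The assumptions on the double-well potential: `W ∈ C^{2,1}[0,1]`, `W(0) = W(1) = 0`, `W > 0` on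
`(0,1)`, `W''(0) > 0`, `W''(1) > 0`, and `∫₀¹ √W = 1`. -/
structure IsDoubleWell (W : ℝ → ℝ) : Prop where
  contDiffOn : ContDiffOn ℝ 2 W (Icc 0 1)
  lipschitz : ∃ L : ℝ≥0, LipschitzOnWith L (iteratedDerivWithin 2 W (Icc 0 1)) (Icc 0 1)
  zero : W 0 = 0
  one : W 1 = 0
  pos : ∀ t ∈ Ioo (0 : ℝ) 1, 0 < W t
  deriv_zero : 0 < iteratedDerivWithin 2 W (Icc 0 1) 0
  deriv_one : 0 < iteratedDerivWithin 2 W (Icc 0 1) 1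
  normalized : ∫ t in (0 : ℝ)..1, √(W t) = 1

/-- `Φ(t) = ∫₀ᵗ √W`. -/
def Phi (W : ℝ → ℝ) (t : ℝ) : ℝ := ∫ s in (0 : ℝ)..t, √(W s)

/-- The volume density `V(t) = Φ(t)^((n+1)/n)`. -/
def volDensity (n : ℕ) (W : ℝ → ℝ) (t : ℝ) : ℝ := Phi W t ^ (((n : ℝ) + 1) / n)

/-! ### Weak gradients, `W^{1,2}_loc`, and the energies -/

/-- `G` is a weak gradient of `u` in the open set `Ω`. -/
structure IsWeakGradient {n : ℕ} (Ω : Set (Space n)) (u : Space n → ℝ) (G : Space n → Space n) :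
    Prop where
  locInt : LocallyIntegrableOn u Ω
  locInt_grad : LocallyIntegrableOn G Ω
  integral_eq : ∀ φ : Space n → ℝ, ContDiff ℝ ∞ φ → HasCompactSupport φ → tsupport φ ⊆ Ω →
    ∀ e : Space n, ∫ x in Ω, u x * fderiv ℝ φ x e = - ∫ x in Ω, φ x * inner ℝ (G x) e

open Classical in
/-- The weak gradient of `u` in `Ω` (unique up to null sets), with value `0` if there is none. -/
def weakGradient {n : ℕ} (Ω : Set (Space n)) (u : Space n → ℝ) : Space n → Space n :=
  if h : ∃ G, IsWeakGradient Ω u G then h.choose else 0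

/-- `u ∈ W^{1,2}_loc(Ω)`. -/
def MemW12Loc {n : ℕ} (Ω : Set (Space n)) (u : Space n → ℝ) : Prop :=
  ∃ G, IsWeakGradient Ω u G ∧ ∀ A ⊆ Ω, IsCompact A →
    MemLp u 2 (volume.restrict A) ∧ MemLp G 2 (volume.restrict A)

/-- The Allen–Cahn energy `∫_Ω ε |∇u|² + W(u)/ε`. -/
def allenCahn {n : ℕ} (W : ℝ → ℝ) (ε : ℝ) (Ω : Set (Space n)) (u : Space n → ℝ) : ℝ≥0∞ :=
  ∫⁻ x in Ω, ENNReal.ofReal (ε * ‖weakGradient Ω u x‖ ^ 2 + W (u x) / ε)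

/-- The diffused volume `∫_Ω V(u)`. -/
def diffVolume {n : ℕ} (W : ℝ → ℝ) (Ω : Set (Space n)) (u : Space n → ℝ) : ℝ≥0∞ :=
  ∫⁻ x in Ω, ENNReal.ofReal (volDensity n W (u x))

end SoapFilm

end

/-! The upper bound comes from a film built as `q (ρ / ε)`, where `ρ` measures the distance to `K`
and `q` falls from a level `a` to `0`. Since `q'² + W ≥ 2 √W |q'|`, one side of the film costs at
least `2 Φ(a)` per unit area, and this is nearly attained by solving `q' = -√(W + τ)` with `τ` small
(`exists_isProfile`). Two sides give `4 Φ(a) ℋⁿ(K)`, and half of this is the claimed bound as `a`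
approaches `δ₀`. Taking `a` at least `δ(ε)` for all small `ε` makes the superlevel set contain `K`,
so it inherits the spanning property.

No regularity of the distance to `K` is available, so `K` is first split. Up to small `ℋⁿ`-measure,
it consists of finitely many disjoint compact sets whose chords are almost parallel to a hyperplane
(`exists_compact_flat_pieces`). This rests on Rademacher's theorem and a Sard-type lemma for points
of degenerate derivative. Each piece lies on a Lipschitz graph of small slope. Integrating along the
normal lines bounds the energy by the profile energy times the area of the projection, which is at
most `ℋⁿ` of the piece, up to small errors (`eventually_exists_film`). The rest of `K` is covered by
a crude cutoff of width `ε`: the lower density bound and Vitali's covering lemma give it volume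
`O(ε)` times the small leftover measure, hence small energy. All these functions are joined by
taking maxima, under which the energy is subadditive (`exists_film`).

The film has support of volume `O(ε)`, negligible against `ν(ε)`. The missing volume is supplied by
a bubble whose radius is tuned by the intermediate value theorem (`exists_bubble_diffVolume_eq`).
Its radius tends to `0` with `ν(ε)`, and its energy is of the order of its surface area, so it does
not affect the limit. -/

namespace SoapFilm

/-! ### Weak gradients of Lipschitz functions, and the energy of a maximum. -/

variable {n : ℕ}

lemma norm_gradient_eq (u : Space n → ℝ) (x : Space n) :
    ‖gradient u x‖ = ‖fderiv ℝ u x‖ := by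
  simp [gradient]

lemma memLp_gradient {C : ℝ≥0} {u : Space n → ℝ} (hu : LipschitzWith C u)
    (μ : Measure (Space n)) : MemLp (gradient u) ⊤ μ := by
  refine memLp_top_of_bound (C := C) ?_ ?_
  · have h : Measurable (fderiv ℝ u) := measurable_fderiv ℝ u
    exact ((InnerProductSpace.toDual ℝ (Space n)).symm.continuous.measurable.comp
      h).aestronglyMeasurable
  · exact .of_forall fun x => by
      rw [norm_gradient_eq]; exact norm_fderiv_le_of_lipschitz ℝ hu

/-- By Rademacher's theorem the classical gradient exists almost everywhere, and Lipschitz functions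
may be integrated by parts against compactly supported ones. -/
lemma isWeakGradient_gradient {Ω : Set (Space n)} {C : ℝ≥0} {u : Space n → ℝ}
    (hu : LipschitzWith C u) : IsWeakGradient Ω u (gradient u) where
  locInt := hu.continuous.locallyIntegrable.locallyIntegrableOn _
  locInt_grad := ((memLp_gradient hu volume).locallyIntegrable le_top).locallyIntegrableOn _
  integral_eq := by
    intro φ hφ hφc hφΩ e
    obtain ⟨D, hD⟩ := ContDiff.lipschitzWith_of_hasCompactSupport hφc hφ (by simp)
    have h1 : ∀ x, x ∉ Ω → u x * fderiv ℝ φ x e = 0 := by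
      intro x hx
      have : x ∉ tsupport (fderiv ℝ φ) := fun h => hx (hφΩ (tsupport_fderiv_subset ℝ h))
      rw [image_eq_zero_of_notMem_tsupport this]
      simp
    have h2 : ∀ x, x ∉ Ω → φ x * inner ℝ (gradient u x) e = 0 := by
      intro x hx
      rw [image_eq_zero_of_notMem_tsupport (fun h => hx (hφΩ h))]
      simp
    rw [setIntegral_eq_integral_of_forall_compl_eq_zero h1,
      setIntegral_eq_integral_of_forall_compl_eq_zero h2]
    have key := LipschitzWith.integral_lineDeriv_mul_eq (μ := volume) hu hD hφc e
    have h3 : ∫ x, lineDeriv ℝ u x e * φ x = ∫ x, φ x * inner ℝ (gradient u x) e := by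
      refine integral_congr_ae ?_
      filter_upwards [hu.ae_differentiableAt] with x hx
      rw [hx.lineDeriv_eq_fderiv, mul_comm]
      simp [gradient]
    have h4 : ∫ x, lineDeriv ℝ φ x (-e) * u x = - ∫ x, u x * fderiv ℝ φ x e := by
      rw [← integral_neg]
      refine integral_congr_ae (.of_forall fun x => ?_)
      have : DifferentiableAt ℝ φ x := (hφ.differentiable (by simp)) x
      simp only [this.lineDeriv_eq_fderiv, map_neg]
      ring
    rw [← h3, key, h4, neg_neg]

/-- Since `weakGradient` is an arbitrary choice, uniqueness is what lets the energy be computed with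
the classical gradient. Testing in each direction `e` reduces it to the fundamental lemma of the
calculus of variations. -/
lemma IsWeakGradient.ae_eq {Ω : Set (Space n)} (hΩ : IsOpen Ω) {u : Space n → ℝ}
    {G G' : Space n → Space n} (h : IsWeakGradient Ω u G) (h' : IsWeakGradient Ω u G') :
    ∀ᵐ x ∂volume, x ∈ Ω → G x = G' x := by
  have key : ∀ᵐ x ∂volume, x ∈ Ω → (G - G') x = 0 := by
    refine hΩ.ae_eq_zero_of_integral_contDiff_smul_eq_zero (h.locInt_grad.sub h'.locInt_grad) ?_
    intro φ hφ hφc hφΩ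
    have hprod : ∀ H : Space n → Space n, LocallyIntegrableOn H Ω volume →
        Integrable (fun x => φ x • H x) volume := by
      intro H hH
      have hs : Function.support (fun x => φ x • H x) ⊆ tsupport φ := fun x hx => by
        refine subset_tsupport _ ?_
        simp only [Function.mem_support] at hx ⊢
        exact fun h0 => hx (by simp [h0])
      rw [← integrableOn_iff_integrable_of_support_subset hs]
      exact (hH.integrableOn_compact_subset hφΩ hφc).continuousOn_smul
        hφ.continuous.continuousOn hφc
    have hsplit : ∫ x, φ x • (G - G') x = (∫ x, φ x • G x) - ∫ x, φ x • G' x := by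
      rw [← integral_sub (hprod _ h.locInt_grad) (hprod _ h'.locInt_grad)]
      simp [smul_sub]
    rw [hsplit, sub_eq_zero]
    have hpair : ∀ H : Space n → Space n, LocallyIntegrableOn H Ω volume → ∀ e,
        inner ℝ e (∫ x, φ x • H x) = ∫ x in Ω, φ x * inner ℝ (H x) e := by
      intro H hH e
      rw [← integral_inner (hprod H hH) e, setIntegral_eq_integral_of_forall_compl_eq_zero]
      · refine integral_congr_ae (.of_forall fun x => ?_)
        simp only [inner_smul_right, real_inner_comm]
      · intro x hx
        rw [image_eq_zero_of_notMem_tsupport (fun h => hx (hφΩ h))]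
        simp
    refine ext_inner_left ℝ fun e => ?_
    rw [hpair G h.locInt_grad, hpair G' h'.locInt_grad]
    have a1 := h.integral_eq φ hφ hφc hφΩ e
    have a2 := h'.integral_eq φ hφ hφc hφΩ e
    linarith
  filter_upwards [key] with x hx hxΩ
  exact sub_eq_zero.1 (hx hxΩ)

lemma weakGradient_ae_eq {Ω : Set (Space n)} (hΩ : IsOpen Ω) {C : ℝ≥0} {u : Space n → ℝ}
    (hu : LipschitzWith C u) : ∀ᵐ x ∂volume, x ∈ Ω → weakGradient Ω u x = gradient u x := by
  have hex : ∃ G, IsWeakGradient Ω u G := ⟨_, isWeakGradient_gradient hu⟩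
  have : weakGradient Ω u = hex.choose := by simp [weakGradient, hex]
  rw [this]
  exact hex.choose_spec.ae_eq hΩ (isWeakGradient_gradient hu)

lemma memW12Loc_of_lipschitz {Ω : Set (Space n)} {C : ℝ≥0} {u : Space n → ℝ}
    (hu : LipschitzWith C u) : MemW12Loc Ω u := by
  refine ⟨gradient u, isWeakGradient_gradient hu, fun A _ hAc => ?_⟩
  have : IsFiniteMeasure (volume.restrict A) := ⟨by simpa using hAc.measure_lt_top⟩
  refine ⟨?_, (memLp_gradient hu _).mono_exponent le_top⟩
  obtain ⟨M, hM⟩ := hAc.exists_bound_of_continuousOn hu.continuous.continuousOn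
  refine MemLp.of_bound hu.continuous.aestronglyMeasurable M ?_
  filter_upwards [ae_restrict_mem hAc.measurableSet] with x hx using hM x hx

/-- The Allen–Cahn energy density of a Lipschitz function, in terms of its classical derivative. -/
noncomputable def energyDensity (W : ℝ → ℝ) (ε : ℝ) (u : Space n → ℝ) (x : Space n) : ℝ≥0∞ :=
  ENNReal.ofReal (ε * ‖fderiv ℝ u x‖ ^ 2 + W (u x) / ε)

lemma allenCahn_le_lintegral {W : ℝ → ℝ} {ε : ℝ} {Ω : Set (Space n)} (hΩ : IsOpen Ω) {C : ℝ≥0}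
    {u : Space n → ℝ} (hu : LipschitzWith C u) :
    allenCahn W ε Ω u ≤ ∫⁻ x, energyDensity W ε u x := by
  refine le_trans (le_of_eq ?_) (setLIntegral_le_lintegral Ω _)
  refine setLIntegral_congr_fun_ae hΩ.measurableSet ?_
  filter_upwards [weakGradient_ae_eq hΩ hu] with x hx hxΩ
  rw [hx hxΩ, norm_gradient_eq, energyDensity]

/-- A Lipschitz function on the whole space with values in `[0,1]`. -/
structure IsPhase (u : Space n → ℝ) : Prop where
  lipschitz : ∃ C : ℝ≥0, LipschitzWith C u
  nonneg : ∀ x, 0 ≤ u x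
  le_one : ∀ x, u x ≤ 1

lemma IsPhase.zero : IsPhase (fun _ : Space n => (0 : ℝ)) :=
  ⟨⟨0, LipschitzWith.const 0⟩, fun _ => le_rfl, fun _ => zero_le_one⟩

lemma IsPhase.max {u v : Space n → ℝ} (hu : IsPhase u) (hv : IsPhase v) :
    IsPhase (fun x => max (u x) (v x)) := by
  obtain ⟨C, hC⟩ := hu.lipschitz
  obtain ⟨D, hD⟩ := hv.lipschitz
  exact ⟨⟨_, hC.max hD⟩, fun x => le_max_of_le_left (hu.nonneg x),
    fun x => max_le (hu.le_one x) (hv.le_one x)⟩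

lemma fderiv_eq_of_le_of_eq {u v : Space n → ℝ} {x : Space n} (hu : DifferentiableAt ℝ u x)
    (hv : DifferentiableAt ℝ v x) (hle : ∀ y, u y ≤ v y) (hx : u x = v x) :
    fderiv ℝ v x = fderiv ℝ u x := by
  have hmin : IsLocalMin (v - u) x := .of_forall fun y => by
    simp only [Pi.sub_apply]
    linarith [hle y]
  have h := hmin.fderiv_eq_zero
  rw [fderiv_sub hv hu] at h
  exact sub_eq_zero.1 h

/-- At almost every point `u`, `v` and their maximum are all differentiable. There the maximum
touches the larger of the two from above, so it has the same gradient and the same density as that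
function. -/
lemma lintegral_energyDensity_max_le {W : ℝ → ℝ} {ε : ℝ} {u v : Space n → ℝ} (hu : IsPhase u)
    (hv : IsPhase v) (hWv : Measurable (energyDensity W ε v)) :
    ∫⁻ x, energyDensity W ε (fun y => max (u y) (v y)) x
      ≤ (∫⁻ x, energyDensity W ε u x) + ∫⁻ x, energyDensity W ε v x := by
  rw [← lintegral_add_right _ hWv]
  refine lintegral_mono_ae ?_
  obtain ⟨C, hC⟩ := hu.lipschitz
  obtain ⟨D, hD⟩ := hv.lipschitz
  filter_upwards [hC.ae_differentiableAt, hD.ae_differentiableAt,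
    (hC.max hD).ae_differentiableAt] with x h1 h2 h3
  rcases le_total (u x) (v x) with h | h
  · refine le_add_left (le_of_eq ?_)
    have := fderiv_eq_of_le_of_eq h2 h3 (fun y => le_max_right _ _) (by simp [h])
    rw [energyDensity, energyDensity, this, max_eq_right h]
  · refine le_add_right (le_of_eq ?_)
    have := fderiv_eq_of_le_of_eq h1 h3 (fun y => le_max_left _ _) (by simp [h])
    rw [energyDensity, energyDensity, this, max_eq_left h]

end SoapFilm

/-! ### Hausdorff measure of images, and a Sard-type lemma. -/

namespace SoapFilm

lemma euclideanHausdorffMeasure_image_le {X Y : Type*} [MetricSpace X] [MeasurableSpace X]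
    [BorelSpace X] [MetricSpace Y] [MeasurableSpace Y] [BorelSpace Y] {K : ℝ≥0} {f : X → Y}
    {s : Set X} (h : LipschitzOnWith K f s) (d : ℕ) :
    μHE[d] (f '' s) ≤ (K : ℝ≥0∞) ^ d * μHE[d] s := by
  simp only [Measure.euclideanHausdorffMeasure_def, Measure.smul_apply,
    Measure.nnreal_smul_coe_apply]
  have := h.hausdorffMeasure_image_le (d := d) (by positivity)
  rw [mul_left_comm]
  gcongr
  simpa using this

/-- On `s` the map `f` factors through `g`: equal values of `g` force equal values of `f`, and the
induced map on `g '' s` is `K`-Lipschitz. -/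
lemma euclideanHausdorffMeasure_image_le_image {U X Y : Type*} [MetricSpace X]
    [MeasurableSpace X] [BorelSpace X] [MetricSpace Y] [MeasurableSpace Y] [BorelSpace Y]
    {K : ℝ≥0} {f : U → Y} {g : U → X} {s : Set U}
    (h : ∀ x ∈ s, ∀ y ∈ s, dist (f x) (f y) ≤ K * dist (g x) (g y)) (d : ℕ) :
    μHE[d] (f '' s) ≤ (K : ℝ≥0∞) ^ d * μHE[d] (g '' s) := by
  rcases s.eq_empty_or_nonempty with rfl | ⟨x₀, hx₀⟩
  · simp
  have : Nonempty U := ⟨x₀⟩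
  set j := Function.invFunOn g s
  have hj : ∀ z ∈ g '' s, j z ∈ s ∧ g (j z) = z := fun z hz =>
    ⟨Function.invFunOn_mem hz, Function.invFunOn_eq hz⟩
  have hL : LipschitzOnWith K (f ∘ j) (g '' s) := by
    refine LipschitzOnWith.of_dist_le_mul fun z hz w hw => ?_
    have := h _ (hj z hz).1 _ (hj w hw).1
    rwa [(hj z hz).2, (hj w hw).2] at this
  have himg : f '' s = (f ∘ j) '' (g '' s) := by
    rw [image_image]
    refine image_congr fun x hx => ?_
    have hgx := hj (g x) (mem_image_of_mem g hx)
    have := h _ hx _ hgx.1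
    rw [hgx.2, dist_self, mul_zero] at this
    exact dist_le_zero.1 this
  rw [himg]
  exact euclideanHausdorffMeasure_image_le hL d

section Degenerate

variable {U V : Type*} [NormedAddCommGroup U] [InnerProductSpace ℝ U] 
  [NormedAddCommGroup V] [InnerProductSpace ℝ V]

/-- The map `x ↦ (A x, η x)`, with values in the Euclidean product. -/
noncomputable def graphMap (A : U →L[ℝ] V) (η : ℝ) : U →ₗ[ℝ] WithLp 2 (V × U) :=
  (WithLp.linearEquiv 2 ℝ (V × U)).symm.toLinearMap ∘ₗ
    (A.toLinearMap.prod (η • LinearMap.id))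

lemma inner_graphMap (A : U →L[ℝ] V) (η : ℝ) (x y : U) :
    inner ℝ (graphMap A η x) (graphMap A η y) = inner ℝ (A x) (A y) + η ^ 2 * inner ℝ x y := by
  simp [graphMap, WithLp.prod_inner_apply, inner_smul_left, inner_smul_right]
  ring

lemma norm_sq_graphMap (A : U →L[ℝ] V) (η : ℝ) (x : U) :
    ‖graphMap A η x‖ ^ 2 = ‖A x‖ ^ 2 + η ^ 2 * ‖x‖ ^ 2 := by
  rw [← real_inner_self_eq_norm_sq, inner_graphMap, real_inner_self_eq_norm_sq,
    real_inner_self_eq_norm_sq]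

/-- The squared Jacobian is a Gram determinant, continuous in `η`, and at `η = 0` it vanishes
because `A` has a kernel. -/
lemma exists_normDet_graphMap_le [FiniteDimensional ℝ U] (A : U →L[ℝ] V)
    (hA : A.toLinearMap.ker ≠ ⊥) {κ : ℝ}
    (hκ : 0 < κ) : ∃ η : ℝ≥0, η ≠ 0 ∧ (graphMap A η).normDet ≤ κ := by
  classical
  let b := stdOrthonormalBasis ℝ U
  have hcont : Continuous fun η : ℝ => (Matrix.gram ℝ (fun i => graphMap A η (b i))).det := by
    refine Continuous.matrix_det ?_
    refine continuous_matrix fun i j => ?_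
    simp only [Matrix.gram_apply, inner_graphMap]
    fun_prop
  have h0 : (Matrix.gram ℝ (fun i => graphMap A 0 (b i))).det = 0 := by
    have h1 := (A.toLinearMap).normDet_sq_eq_det_gram b
    have h2 : A.toLinearMap.normDet = 0 := LinearMap.normDet_eq_zero_iff_ker_ne_bot.2 hA
    rw [h2] at h1
    have h3 : (Matrix.gram ℝ (fun i => graphMap A 0 (b i)))
        = Matrix.gram ℝ (fun i => A.toLinearMap (b i)) := by
      ext i j
      rw [Matrix.gram_apply, Matrix.gram_apply, inner_graphMap]
      simp
    rw [h3, ← h1]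
    simp
  have hev : ∀ᶠ η : ℝ in 𝓝[>] 0,
      (Matrix.gram ℝ (fun i => graphMap A η (b i))).det < κ ^ 2 := by
    have : Tendsto (fun η : ℝ => (Matrix.gram ℝ (fun i => graphMap A η (b i))).det) (𝓝[>] 0)
        (𝓝 0) := by
      have := (hcont.tendsto 0).mono_left (nhdsWithin_le_nhds (s := Ioi 0))
      rwa [h0] at this
    exact this.eventually_lt_const (by positivity)
  obtain ⟨η, hη, hη0⟩ := (hev.and self_mem_nhdsWithin).exists
  refine ⟨η.toNNReal, (Real.toNNReal_pos.2 hη0).ne', ?_⟩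
  · rw [Real.coe_toNNReal _ (le_of_lt hη0)]
    have h1 := (graphMap A η).normDet_sq_eq_det_gram b
    simp only [RCLike.ofReal_real_eq_id, id_eq] at h1
    rw [← h1] at hη
    exact (abs_le_of_sq_le_sq' hη.le hκ.le).2

variable [FiniteDimensional ℝ U] [FiniteDimensional ℝ V]
  [MeasurableSpace U] [BorelSpace U] [MeasurableSpace V] [BorelSpace V]

/-- Where `f` is within `η ‖x - y‖` of a degenerate linear map `A`, its increments are at most twice
those of `x ↦ (A x, η x)`. The Jacobian of this linear map can be made as small as desired, and so
can the measure of the image of a bounded set. -/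
lemma euclideanHausdorffMeasure_image_eq_zero_of_ker_ne_bot {f : U → V} {s : Set U}
    {f' : U → U →L[ℝ] V} (hf : ∀ x ∈ s, HasFDerivWithinAt f (f' x) s x)
    (hker : ∀ x ∈ s, (f' x).toLinearMap.ker ≠ ⊥) :
    μHE[Module.finrank ℝ U] (f '' s) = 0 := by
  set d := Module.finrank ℝ U
  suffices hball : ∀ k : ℕ, μHE[d] (f '' (s ∩ Metric.ball 0 k)) = 0 by
    have : f '' s = ⋃ k : ℕ, f '' (s ∩ Metric.ball 0 k) := by
      rw [← image_iUnion, ← inter_iUnion, Metric.iUnion_ball_nat, inter_univ]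
    rw [this]
    exact measure_iUnion_null hball
  intro k
  set D := s ∩ Metric.ball (0 : U) k
  have hbound : ∀ κ : ℝ, 0 < κ →
      μHE[d] (f '' D) ≤ 2 ^ d * (ENNReal.ofReal κ * volume (Metric.ball (0 : U) k)) := by
    intro κ hκ
    choose! r hr0 hr using fun (A : U →L[ℝ] V) (hA : A.toLinearMap.ker ≠ ⊥) =>
      exists_normDet_graphMap_le A hA hκ
    classical
    -- The value `1` is never used: every `A i` below is a derivative at a point of `D`, hence
    -- degenerate.
    let r' : (U →L[ℝ] V) → ℝ≥0 := fun A => if A.toLinearMap.ker ≠ ⊥ then r A else 1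
    obtain ⟨t, A, ht_disj, ht_meas, ht_cov, ht_app, ht_der⟩ :=
      exists_partition_approximatesLinearOn_of_hasFDerivWithinAt f D f'
        (fun x hx => (hf x hx.1).mono inter_subset_left) r' (fun A => by
          by_cases hA : A.toLinearMap.ker ≠ ⊥
          · simpa [r', hA] using hr0 A hA
          · simp only [r', if_neg hA]
            exact one_ne_zero)
    rcases D.eq_empty_or_nonempty with hD | hD
    · simp [hD]
    have hA : ∀ i, (A i).toLinearMap.ker ≠ ⊥ := fun i => by
      obtain ⟨y, hy, hAy⟩ := ht_der hD i
      rw [hAy]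
      exact hker y hy.1
    have hpiece : ∀ i, μHE[d] (f '' (D ∩ t i)) ≤
        2 ^ d * (ENNReal.ofReal κ * volume (Metric.ball (0 : U) k ∩ t i)) := by
      intro i
      have hstep : μHE[d] (f '' (D ∩ t i)) ≤
          ((2 : ℝ≥0) : ℝ≥0∞) ^ d * μHE[d] (graphMap (A i) (r (A i)) '' (D ∩ t i)) := by
        refine euclideanHausdorffMeasure_image_le_image (fun x hx y hy => ?_) d
        have h1 := ht_app i x hx y hy
        have h2 : r' (A i) = r (A i) := if_pos (hA i)
        rw [h2] at h1
        rw [dist_eq_norm, dist_eq_norm, ← map_sub]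
        have h3 := norm_sq_graphMap (A i) (r (A i)) (x - y)
        have h4 : ‖A i (x - y)‖ ≤ ‖graphMap (A i) (r (A i)) (x - y)‖ :=
          abs_le_of_sq_le_sq' (by rw [h3]; nlinarith [sq_nonneg ((r (A i) : ℝ) * ‖x - y‖)])
            (norm_nonneg _) |>.2
        have h5 : (r (A i) : ℝ) * ‖x - y‖ ≤ ‖graphMap (A i) (r (A i)) (x - y)‖ :=
          abs_le_of_sq_le_sq' (by rw [h3]; nlinarith [sq_nonneg ‖A i (x - y)‖])
            (norm_nonneg _) |>.2
        calc ‖f x - f y‖ = ‖(f x - f y - A i (x - y)) + A i (x - y)‖ := by congr 1; abel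
          _ ≤ _ := norm_add_le _ _
          _ ≤ ((2 : ℝ≥0) : ℝ) * ‖graphMap (A i) (r (A i)) (x - y)‖ := by
              push_cast
              linarith
      refine hstep.trans ?_
      rw [LinearMap.euclideanHausdorffMeasure_image_eq_normDet_mul_volume]
      push_cast
      gcongr
      · exact hr _ (hA i)
      · exact inter_subset_right
    calc μHE[d] (f '' D) ≤ μHE[d] (⋃ i, f '' (D ∩ t i)) := by
          refine measure_mono ?_
          rw [← image_iUnion, ← inter_iUnion, inter_eq_self_of_subset_left ht_cov]
      _ ≤ ∑' i, μHE[d] (f '' (D ∩ t i)) := measure_iUnion_le _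
      _ ≤ ∑' i, 2 ^ d * (ENNReal.ofReal κ * volume (Metric.ball (0 : U) k ∩ t i)) :=
          ENNReal.tsum_le_tsum hpiece
      _ = 2 ^ d * (ENNReal.ofReal κ * ∑' i, volume (Metric.ball (0 : U) k ∩ t i)) := by
          rw [ENNReal.tsum_mul_left, ENNReal.tsum_mul_left]
      _ ≤ _ := by
          gcongr
          rw [← measure_iUnion]
          · exact measure_mono (iUnion_subset fun i => inter_subset_left)
          · exact fun i j hij => (ht_disj hij).mono inter_subset_right inter_subset_right
          · exact fun i => Metric.isOpen_ball.measurableSet.inter (ht_meas i)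
  have hlim : Tendsto (fun κ : ℝ =>
      2 ^ d * (ENNReal.ofReal κ * volume (Metric.ball (0 : U) k))) (𝓝[>] 0) (𝓝 0) := by
    have h1 : Tendsto (fun κ : ℝ => ENNReal.ofReal κ) (𝓝[>] 0) (𝓝 0) := by
      have := (ENNReal.continuous_ofReal.tendsto 0).mono_left
        (nhdsWithin_le_nhds (s := Ioi (0 : ℝ)))
      simpa using this
    have h2 := ENNReal.Tendsto.mul_const (b := volume (Metric.ball (0 : U) k)) h1
      (Or.inr measure_ball_lt_top.ne)
    have h3 := ENNReal.Tendsto.const_mul (a := (2 : ℝ≥0∞) ^ d) h2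
      (Or.inr (ENNReal.pow_ne_top ENNReal.ofNat_ne_top))
    simpa using h3
  refine le_antisymm (ge_of_tendsto hlim ?_) bot_le
  filter_upwards [self_mem_nhdsWithin] with κ hκ using hbound κ hκ

end Degenerate

/-! ### Covering a rectifiable set by almost flat closed sets. -/

variable {n : ℕ}

/-- All chords of `S` make a small angle (of sine at most `σ`) with a fixed hyperplane. -/
def IsFlat (σ : ℝ) (S : Set (Space n)) : Prop :=
  ∃ N : Space n, ‖N‖ = 1 ∧ ∀ x ∈ S, ∀ y ∈ S, |inner ℝ N (x - y)| ≤ σ * ‖x - y‖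

lemma IsFlat.mono {σ : ℝ} {S S' : Set (Space n)} (h : IsFlat σ S) (hS : S' ⊆ S) :
    IsFlat σ S' := by
  obtain ⟨N, hN, h⟩ := h
  exact ⟨N, hN, fun x hx y hy => h x (hS hx) y (hS hy)⟩

lemma IsFlat.closure {σ : ℝ} {S : Set (Space n)} (h : IsFlat σ S) : IsFlat σ (closure S) := by
  obtain ⟨N, hN, h⟩ := h
  refine ⟨N, hN, fun x hx y hy => ?_⟩
  have hcl : IsClosed {p : Space n × Space n | |inner ℝ N (p.1 - p.2)| ≤ σ * ‖p.1 - p.2‖} :=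
    isClosed_le (by fun_prop) (by fun_prop)
  have hsub : S ×ˢ S ⊆ {p : Space n × Space n | |inner ℝ N (p.1 - p.2)| ≤ σ * ‖p.1 - p.2‖} :=
    fun p hp => h _ hp.1 _ hp.2
  have := hcl.closure_subset_iff.2 hsub
  rw [closure_prod_eq] at this
  exact this (mk_mem_prod hx hy)

lemma exists_unit_orthogonal (A : EuclideanSpace ℝ (Fin n) →L[ℝ] Space n) :
    ∃ N : Space n, ‖N‖ = 1 ∧ ∀ x, inner ℝ N (A x) = 0 := by
  have hlt : A.toLinearMap.range ≠ ⊤ := by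
    intro h
    have h1 := LinearMap.finrank_range_le A.toLinearMap
    rw [h, finrank_top] at h1
    simp at h1
  have hne : A.toLinearMap.rangeᗮ ≠ ⊥ := by
    intro h
    exact hlt ((Submodule.orthogonal_eq_bot_iff).1 h)
  obtain ⟨v, hv, hv0⟩ := Submodule.exists_mem_ne_zero_of_ne_bot hne
  refine ⟨(‖v‖⁻¹ : ℝ) • v, norm_smul_inv_norm hv0, fun x => ?_⟩
  have : inner ℝ v (A x) = 0 :=
    Submodule.inner_left_of_mem_orthogonal (K := A.toLinearMap.range) ⟨x, rfl⟩ hv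
  rw [inner_smul_left, this, mul_zero]

/-- Take `N` orthogonal to the range of `A`. The `N`-component of a chord is pure approximation
error, at most `r ‖x - y‖`, while the chord itself has length at least `(a - r) ‖x - y‖`. -/
lemma isFlat_image_of_approximatesLinearOn {f : EuclideanSpace ℝ (Fin n) → Space n}
    {A : EuclideanSpace ℝ (Fin n) →L[ℝ] Space n} {s : Set (EuclideanSpace ℝ (Fin n))}
    {r : ℝ≥0} {a σ : ℝ} (hf : ApproximatesLinearOn f A s r) (hA : ∀ x, a * ‖x‖ ≤ ‖A x‖)
    (hσ : 0 ≤ σ) (hr : r ≤ σ * (a - r)) : IsFlat σ (f '' s) := by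
  obtain ⟨N, hN, hNA⟩ := exists_unit_orthogonal A
  refine ⟨N, hN, ?_⟩
  rintro _ ⟨x, hx, rfl⟩ _ ⟨y, hy, rfl⟩
  have h1 := hf x hx y hy
  have h2 : inner ℝ N (f x - f y) = inner ℝ N (f x - f y - A (x - y)) := by
    rw [inner_sub_right _ _ (A (x - y)), hNA, sub_zero]
  have h3 : |inner ℝ N (f x - f y)| ≤ r * ‖x - y‖ := by
    rw [h2]
    refine (abs_real_inner_le_norm _ _).trans ?_
    rwa [hN, one_mul]
  have h4 : (a - r) * ‖x - y‖ ≤ ‖f x - f y‖ := by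
    have h5 : ‖A (x - y)‖ ≤ ‖f x - f y‖ + ‖f x - f y - A (x - y)‖ := by
      calc ‖A (x - y)‖ = ‖(f x - f y) - (f x - f y - A (x - y))‖ := by congr 1; abel
        _ ≤ _ := norm_sub_le _ _
    have := hA (x - y)
    linarith
  calc _ ≤ (r : ℝ) * ‖x - y‖ := h3
    _ ≤ (σ * (a - r)) * ‖x - y‖ := by gcongr
    _ = σ * ((a - r) * ‖x - y‖) := by ring
    _ ≤ _ := by gcongr

/-- Points of non-differentiability and points of degenerate derivative have null image. The
remaining points split into countably many sets on which `f` is close to an injective linear map,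
and flatness survives closure. -/
lemma exists_isFlat_cover_range {f : EuclideanSpace ℝ (Fin n) → Space n} {L : ℝ≥0}
    (hf : LipschitzWith L f) {σ : ℝ} (hσ : 0 < σ) :
    ∃ T : ℕ → Set (Space n), (∀ i, IsClosed (T i)) ∧ (∀ i, IsFlat σ (T i)) ∧
      μHE[n] (range f \ ⋃ i, T i) = 0 := by
  have hfin : Module.finrank ℝ (EuclideanSpace ℝ (Fin n)) = n := by simp
  set D := {x | DifferentiableAt ℝ f x}
  set D₀ := {x ∈ D | (fderiv ℝ f x).toLinearMap.ker ≠ ⊥}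
  set D₁ := {x ∈ D | (fderiv ℝ f x).toLinearMap.ker = ⊥}
  have hDc : μHE[n] (f '' Dᶜ) = 0 := by
    have h1 : volume Dᶜ = 0 := hf.ae_differentiableAt
    have h2 := euclideanHausdorffMeasure_image_le (hf.lipschitzOnWith (s := Dᶜ)) n
    rw [EuclideanSpace.euclideanHausdorffMeasure_eq_volume, h1, mul_zero] at h2
    exact le_antisymm h2 bot_le
  have hD0 : μHE[n] (f '' D₀) = 0 := by
    have := euclideanHausdorffMeasure_image_eq_zero_of_ker_ne_bot (f := f) (s := D₀)
      (f' := fderiv ℝ f) (fun x hx => hx.1.hasFDerivAt.hasFDerivWithinAt) (fun x hx => hx.2)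
    rwa [hfin] at this
  have hr : ∀ A : EuclideanSpace ℝ (Fin n) →L[ℝ] Space n, ∃ r : ℝ≥0, r ≠ 0 ∧
      (A.toLinearMap.ker = ⊥ → ∃ a : ℝ, (∀ x, a * ‖x‖ ≤ ‖A x‖) ∧ r ≤ σ * (a - r)) := by
    intro A
    by_cases hA : A.toLinearMap.ker = ⊥
    · obtain ⟨K, hK, hKA⟩ := A.toLinearMap.exists_antilipschitzWith hA
      have hK' : (0 : ℝ) < K := hK
      have hpos : 0 < σ * (K : ℝ)⁻¹ / (1 + σ) := by positivity
      -- This is the solution of `r = σ (a - r)` with `a = K⁻¹`.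
      refine ⟨(σ * (K : ℝ)⁻¹ / (1 + σ)).toNNReal, (Real.toNNReal_pos.2 hpos).ne',
        fun _ => ⟨(K : ℝ)⁻¹, fun x => ?_, ?_⟩⟩
      · have := hKA.le_mul_dist x 0
        simp only [dist_zero_right, map_zero] at this
        rw [inv_mul_le_iff₀ hK']
        exact this
      · apply le_of_eq
        rw [Real.coe_toNNReal _ hpos.le]
        field_simp
        ring
    · exact ⟨1, one_ne_zero, fun h => absurd h hA⟩
  choose r hr0 hr using hr
  obtain ⟨t, A, -, ht_cov, ht_app, ht_der⟩ :=
    exists_closed_cover_approximatesLinearOn_of_hasFDerivWithinAt f D₁ (fderiv ℝ f)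
      (fun x hx => hx.1.hasFDerivAt.hasFDerivWithinAt) r hr0
  refine ⟨fun i => closure (f '' (D₁ ∩ t i)), fun i => isClosed_closure, fun i => ?_, ?_⟩
  · refine IsFlat.closure ?_
    rcases D₁.eq_empty_or_nonempty with hD | hD
    · obtain ⟨N, hN, -⟩ := exists_unit_orthogonal (A i)
      exact ⟨N, hN, by simp [hD]⟩
    obtain ⟨y, hy, hAy⟩ := ht_der hD i
    obtain ⟨a, ha, hra⟩ := hr (A i) (by rw [hAy]; exact hy.2)
    exact isFlat_image_of_approximatesLinearOn (ht_app i) ha hσ.le hra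
  · refine measure_mono_null (t := f '' Dᶜ ∪ f '' D₀) ?_ (measure_union_null hDc hD0)
    rintro _ ⟨⟨x, rfl⟩, hx⟩
    by_cases hxD : x ∈ D
    · by_cases hk : (fderiv ℝ f x).toLinearMap.ker = ⊥
      · exfalso
        obtain ⟨i, hi⟩ := mem_iUnion.1 (ht_cov ⟨hxD, hk⟩)
        exact hx (mem_iUnion.2 ⟨i, subset_closure ⟨x, ⟨⟨hxD, hk⟩, hi⟩, rfl⟩⟩)
      · exact Or.inr ⟨x, ⟨hxD, hk⟩, rfl⟩
    · exact Or.inl ⟨x, hxD, rfl⟩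

lemma IsRectifiable.exists_isFlat_cover {K : Set (Space n)} (hK : IsRectifiable n K) {σ : ℝ}
    (hσ : 0 < σ) :
    ∃ T : ℕ → Set (Space n), (∀ i, IsClosed (T i)) ∧ (∀ i, IsFlat σ (T i)) ∧
      μHE[n] (K \ ⋃ i, T i) = 0 := by
  obtain ⟨f, hf, hcov⟩ := hK.cover
  choose L hL using hf
  choose T hTc hTf hT0 using fun i => exists_isFlat_cover_range (hL i) hσ
  refine ⟨fun k => T k.unpair.1 k.unpair.2, fun k => hTc _ _, fun k => hTf _ _, ?_⟩
  refine measure_mono_null (t := (K \ ⋃ i, range (f i)) ∪ ⋃ i, (range (f i) \ ⋃ j, T i j)) ?_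
    (measure_union_null hcov (measure_iUnion_null hT0))
  rintro x ⟨hxK, hx⟩
  by_cases hxr : x ∈ ⋃ i, range (f i)
  · obtain ⟨i, hi⟩ := mem_iUnion.1 hxr
    refine Or.inr (mem_iUnion.2 ⟨i, hi, fun hj => hx ?_⟩)
    obtain ⟨j, hj⟩ := mem_iUnion.1 hj
    exact mem_iUnion.2 ⟨Nat.pair i j, by simpa using hj⟩
  · exact Or.inl ⟨hxK, hxr⟩

end SoapFilm

/-! ### The one-dimensional transition profile. -/

namespace SoapFilm

/-- Separation of variables: the solution is the inverse of `G = ∫ 1/f`. The bound `f ≤ b` makes `G`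
grow at least linearly, hence surjective. No Lipschitz condition on `f` is needed. -/
lemma exists_autonomous_solution {f : ℝ → ℝ} (hf : Continuous f) {c b : ℝ} (hc : 0 < c)
    (hcf : ∀ t, c ≤ f t) (hfb : ∀ t, f t ≤ b) :
    ∃ φ : ℝ → ℝ, φ 0 = 0 ∧ ∀ s, HasDerivAt φ (f (φ s)) s := by
  have hpos : ∀ t, 0 < f t := fun t => hc.trans_le (hcf t)
  have hb : 0 < b := (hpos 0).trans_le (hfb 0)
  have hinv : Continuous fun t => (f t)⁻¹ := hf.inv₀ fun t => (hpos t).ne'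
  set G : ℝ → ℝ := fun t => ∫ s in (0 : ℝ)..t, (f s)⁻¹
  have hG : ∀ t, HasDerivAt G (f t)⁻¹ t := fun t =>
    intervalIntegral.integral_hasDerivAt_right (hinv.intervalIntegrable _ _)
      hinv.stronglyMeasurable.stronglyMeasurableAtFilter hinv.continuousAt
  have hGc : Continuous G := continuous_iff_continuousAt.2 fun t => (hG t).continuousAt
  have hGm : StrictMono G := strictMono_of_hasDerivAt_pos hG fun t => inv_pos.2 (hpos t)
  have hmono : Monotone fun t => G t - b⁻¹ * t := by
    refine monotone_of_hasDerivAt_nonneg (f' := fun t => (f t)⁻¹ - b⁻¹ * 1)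
      (fun t => (hG t).sub ((hasDerivAt_id t).const_mul _)) fun t => ?_
    simp only [mul_one, Pi.zero_apply, sub_nonneg]
    exact inv_anti₀ (hpos t) (hfb t)
  have hG0 : G 0 = 0 := by simp [G]
  have htop : Tendsto G atTop atTop := by
    refine tendsto_atTop_mono' _ ?_ (tendsto_id.const_mul_atTop (inv_pos.2 hb))
    filter_upwards [eventually_ge_atTop 0] with t ht
    have := hmono ht
    simp only [hG0, mul_zero, sub_zero] at this
    simp only [id]
    linarith
  have hbot : Tendsto G atBot atBot := by
    refine tendsto_atBot_mono' _ ?_ (tendsto_id.const_mul_atBot (inv_pos.2 hb))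
    filter_upwards [eventually_le_atBot 0] with t ht
    have := hmono ht
    simp only [hG0, mul_zero, sub_zero] at this
    simp only [id]
    linarith
  set e := hGm.orderIsoOfSurjective G (hGc.surjective htop hbot)
  have he : ∀ s, G (e.symm s) = s := fun s => e.apply_symm_apply s
  refine ⟨e.symm, ?_, fun s => ?_⟩
  · have : e 0 = 0 := hG0
    rw [OrderIso.symm_apply_eq, this]
  · have := HasDerivAt.of_local_left_inverse (e.symm.continuous.continuousAt (x := s)) (hG _)
      (inv_pos.2 (hpos _)).ne' (.of_forall he)
    simpa using this

namespace IsDoubleWell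

variable {W : ℝ → ℝ}

lemma nonneg (hW : IsDoubleWell W) {t : ℝ} (ht : t ∈ Icc (0 : ℝ) 1) : 0 ≤ W t := by
  rcases eq_or_lt_of_le ht.1 with h | h
  · rw [← h, hW.zero]
  rcases eq_or_lt_of_le ht.2 with h' | h'
  · rw [h', hW.one]
  · exact (hW.pos t ⟨h, h'⟩).le

lemma continuousOn (hW : IsDoubleWell W) : ContinuousOn W (Icc 0 1) :=
  hW.contDiffOn.continuousOn

lemma exists_bound (hW : IsDoubleWell W) : ∃ B, 0 < B ∧ ∀ t ∈ Icc (0 : ℝ) 1, W t ≤ B := by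
  obtain ⟨B, hB⟩ := isCompact_Icc.exists_bound_of_continuousOn hW.continuousOn
  refine ⟨max B 1, by positivity, fun t ht => le_max_of_le_left ?_⟩
  exact (le_abs_self _).trans (hB t ht)

/-- A continuous extension of the restriction to `[0,1]`. -/
lemma exists_extension (hW : IsDoubleWell W) : ∃ F : ℝ → ℝ, Continuous F ∧
    (∀ t, 0 ≤ F t) ∧ (∃ B, ∀ t, F t ≤ B) ∧ EqOn F W (Icc 0 1) := by
  obtain ⟨B, -, hB⟩ := hW.exists_bound
  refine ⟨IccExtend zero_le_one ((Icc 0 1).domRestrict W), ?_, fun t => ?_, ⟨B, fun t => ?_⟩,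
    fun t ht => ?_⟩
  · exact (continuousOn_iff_continuous_domRestrict.1 hW.continuousOn).Icc_extend'
  · exact hW.nonneg (projIcc 0 1 zero_le_one t).2
  · exact hB _ (projIcc 0 1 zero_le_one t).2
  · exact IccExtend_of_mem _ _ ht

end IsDoubleWell

/-- A one-dimensional transition profile: it equals `a` up to `l`, vanishes after `T`, and its
energy on the half-line is at most `I`. -/
structure IsProfile (W : ℝ → ℝ) (a l T I : ℝ) (q : ℝ → ℝ) : Prop where
  lipschitz : ∃ C : ℝ≥0, LipschitzWith C q
  mem : ∀ s, q s ∈ Icc 0 a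
  top : ∀ s ≤ l, q s = a
  bot : ∀ s, T ≤ s → q s = 0
  diff : ∀ s, 0 < q s → q s < a → DifferentiableAt ℝ q s
  integral_le : ∫⁻ s in Ioi 0, ENNReal.ofReal (deriv q s ^ 2 + W (q s)) ≤ ENNReal.ofReal I

/-- The profile rests at `a` up to `l`, then descends by `q' = -√(W + τ)`. The shift `τ > 0` keeps
the speed away from zero, so `0` is reached in finite time. The plateau makes the film equal to `a`
on a full neighbourhood, of size comparable to `ε`, of the set it is built on. -/
lemma exists_isProfile {W : ℝ → ℝ} (hW : IsDoubleWell W) {a η : ℝ} (ha : 0 < a) (ha1 : a ≤ 1)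
    (hη : 0 < η) : ∃ l T q, 0 < l ∧ l < T ∧ IsProfile W a l T (2 * Phi W a + η) q := by
  obtain ⟨F, hFc, hF0, ⟨B, hB⟩, hFW⟩ := hW.exists_extension
  have hB0 : 0 ≤ B := (hF0 0).trans (hB 0)
  -- With `√τ = η / 4` and `√(W + τ) ≤ √W + √τ`, the two-fold integral of the speed over `[0, a]`
  -- exceeds `2 Φ(a)` by at most `η / 2`.
  set τ : ℝ := (η / 4) ^ 2
  have hτ : 0 < τ := by positivity
  have hsτ : √τ = η / 4 := Real.sqrt_sq (by positivity)
  set f : ℝ → ℝ := fun t => √(F t + τ)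
  have hfc : Continuous f := by fun_prop
  have hcf : ∀ t, √τ ≤ f t := fun t => Real.sqrt_le_sqrt (by linarith [hF0 t])
  have hfb : ∀ t, f t ≤ √(B + τ) := fun t => Real.sqrt_le_sqrt (by linarith [hB t])
  have hf2 : ∀ t, f t ^ 2 = F t + τ := fun t => Real.sq_sqrt (by linarith [hF0 t])
  have hfpos : ∀ t, 0 < f t := fun t => (by rw [hsτ]; positivity : 0 < √τ).trans_le (hcf t)
  obtain ⟨φ, hφ0, hφ⟩ := exists_autonomous_solution hfc (by rw [hsτ]; positivity) hcf hfb
  have hφm : StrictMono φ := strictMono_of_hasDerivAt_pos hφ fun s => hfpos _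
  have hφc : Continuous φ := continuous_iff_continuousAt.2 fun s => (hφ s).continuousAt
  have hφL : LipschitzWith (√(B + τ)).toNNReal φ := by
    refine lipschitzWith_of_nnnorm_deriv_le (fun s => (hφ s).differentiableAt) fun s => ?_
    rw [(hφ s).deriv, ← NNReal.coe_le_coe, coe_nnnorm, Real.coe_toNNReal _ (Real.sqrt_nonneg _),
      Real.norm_of_nonneg (hfpos _).le]
    exact hfb _
  obtain ⟨S, hS⟩ : ∃ S, φ S = a := by
    have hmono : Monotone fun s => φ s - √τ * s := by
      refine monotone_of_hasDerivAt_nonneg (f' := fun s => f (φ s) - √τ * 1)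
        (fun s => (hφ s).sub ((hasDerivAt_id s).const_mul _)) fun s => ?_
      simp only [mul_one, Pi.zero_apply, sub_nonneg]
      exact hcf _
    have h1 : a ≤ φ (a / √τ) := by
      have hs : 0 < √τ := by rw [hsτ]; positivity
      have := hmono (show 0 ≤ a / √τ by positivity)
      simp only [hφ0, mul_zero, sub_zero] at this
      rw [mul_div_cancel₀ _ hs.ne'] at this
      linarith
    obtain ⟨S, -, hS⟩ := intermediate_value_Icc (show (0 : ℝ) ≤ a / √τ by positivity)
      hφc.continuousOn ⟨by rw [hφ0]; exact ha.le, h1⟩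
    exact ⟨S, hS⟩
  have hS0 : 0 < S := hφm.lt_iff_lt.1 (by rw [hφ0, hS]; exact ha)
  -- The plateau costs at most `B l ≤ η / 2`.
  set l : ℝ := η / (2 * (B + 1))
  have hl : 0 < l := by positivity
  set q : ℝ → ℝ := fun s => max 0 (min a (φ (S + l - s)))
  have hqmem : ∀ s, q s ∈ Icc 0 a := fun s => ⟨le_max_left _ _, max_le ha.le (min_le_left _ _)⟩
  have hqtop : ∀ s ≤ l, q s = a := by
    intro s hs
    have : a ≤ φ (S + l - s) := by rw [← hS]; exact hφm.monotone (by linarith)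
    simp only [q, min_eq_left this, max_eq_right ha.le]
  have hqbot : ∀ s, S + l ≤ s → q s = 0 := by
    intro s hs
    have : φ (S + l - s) ≤ 0 := by rw [← hφ0]; exact hφm.monotone (by linarith)
    simp only [q, min_eq_right (this.trans ha.le), max_eq_left this]
  have hqeq : ∀ s ∈ Ioo l (S + l), q s = φ (S + l - s) := by
    intro s hs
    have h1 : φ (S + l - s) ≤ a := by rw [← hS]; exact hφm.monotone (by linarith [hs.1])
    have h2 : 0 ≤ φ (S + l - s) := by rw [← hφ0]; exact hφm.monotone (by linarith [hs.2])
    simp only [q, min_eq_right h1, max_eq_right h2]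
  have hφd : ∀ s, HasDerivAt (fun s => φ (S + l - s)) (-f (φ (S + l - s))) s := by
    intro s
    have h1 : HasDerivAt (fun s => S + l - s) (-1) s := by
      simpa using (hasDerivAt_id s).const_sub (S + l)
    exact ((hφ (S + l - s)).comp s h1).congr_deriv (by ring)
  have hqd : ∀ s ∈ Ioo l (S + l), HasDerivAt q (-f (φ (S + l - s))) s := by
    intro s hs
    refine (hφd s).congr_of_eventuallyEq ?_
    filter_upwards [isOpen_Ioo.mem_nhds hs] with r hr using hqeq r hr
  have hmin : ∀ s, q s = 0 → deriv q s = 0 := fun s hs =>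
    IsLocalMin.deriv_eq_zero (.of_forall fun r => by rw [hs]; exact (hqmem r).1)
  have hmax : ∀ s, q s = a → deriv q s = 0 := fun s hs =>
    IsLocalMax.deriv_eq_zero (.of_forall fun r => by rw [hs]; exact (hqmem r).2)
  have hqW : ∀ s, W (q s) = F (q s) := fun s =>
    (hFW ⟨(hqmem s).1, (hqmem s).2.trans ha1⟩).symm
  refine ⟨l, S + l, q, hl, by linarith, ?_, hqmem, hqtop, hqbot, fun s h0 h1 => ?_, ?_⟩
  · have h1 : LipschitzWith (√(B + τ)).toNNReal fun s => φ (S + l - s) := by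
      have : LipschitzWith 1 fun s : ℝ => S + l - s :=
        LipschitzWith.of_dist_le_mul fun x y => by
          rw [Real.dist_eq, Real.dist_eq, abs_sub_comm x y]
          apply le_of_eq
          rw [NNReal.coe_one, one_mul]
          congr 1
          ring
      have h2 := hφL.comp this
      rwa [mul_one] at h2
    exact ⟨_, (h1.const_min a).const_max 0⟩
  · refine (hqd s ⟨?_, ?_⟩).differentiableAt
    · by_contra h
      exact h1.ne (hqtop s (not_lt.1 h))
    · by_contra h
      exact h0.ne' (hqbot s (not_lt.1 h))
  · set h : ℝ → ℝ≥0∞ := fun s => ENNReal.ofReal (deriv q s ^ 2 + W (q s))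
    have hsub : Ioi (0 : ℝ) ⊆ (Ioc 0 l ∪ Ioc l (S + l)) ∪ Ioi (S + l) := by
      intro s hs
      rcases le_or_gt s l with h1 | h1
      · exact Or.inl (Or.inl ⟨hs, h1⟩)
      rcases le_or_gt s (S + l) with h2 | h2
      · exact Or.inl (Or.inr ⟨h1, h2⟩)
      · exact Or.inr h2
    have e1 : ∫⁻ s in Ioc 0 l, h s ≤ ENNReal.ofReal (η / 2) := by
      calc ∫⁻ s in Ioc 0 l, h s ≤ ∫⁻ s in Ioc 0 l, ENNReal.ofReal B := by
            refine setLIntegral_mono' measurableSet_Ioc fun s hs => ?_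
            refine ENNReal.ofReal_le_ofReal ?_
            rw [hmax s (hqtop s hs.2), hqW]
            simpa using hB _
        _ = ENNReal.ofReal (B * l) := by
            rw [setLIntegral_const, Real.volume_Ioc, sub_zero, ENNReal.ofReal_mul hB0]
        _ ≤ _ := by
            refine ENNReal.ofReal_le_ofReal ?_
            simp only [l]
            rw [mul_div_assoc', div_le_div_iff₀ (by positivity) (by positivity)]
            nlinarith
    have e3 : ∫⁻ s in Ioi (S + l), h s = 0 := by
      rw [setLIntegral_congr_fun measurableSet_Ioi (g := fun _ => 0)]
      · simp
      · intro s hs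
        have := hqbot s (le_of_lt hs)
        simp only [h, hmin s this, this, hW.zero]
        simp
    have e2 : ∫⁻ s in Ioc l (S + l), h s ≤ ENNReal.ofReal (2 * Phi W a + η / 2) := by
      -- Here `q'² + W ≤ 2 f(q)² = -2 f(q) q'`, an exact derivative, so the integral becomes `2 ∫ f`
      -- over `[0, a]`.
      have hg : Continuous fun s => 2 * f (φ (S + l - s)) ^ 2 := by fun_prop
      calc ∫⁻ s in Ioc l (S + l), h s
          ≤ ∫⁻ s in Ioc l (S + l), ENNReal.ofReal (2 * f (φ (S + l - s)) ^ 2) := by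
            refine setLIntegral_mono' measurableSet_Ioc fun s hs => ?_
            refine ENNReal.ofReal_le_ofReal ?_
            rcases eq_or_lt_of_le hs.2 with h1 | h1
            · have := hqbot s h1.ge
              rw [hmin s this, this, hW.zero]
              simp only [ne_eq, OfNat.ofNat_ne_zero, not_false_eq_true, zero_pow, add_zero]
              positivity
            · rw [(hqd s ⟨hs.1, h1⟩).deriv, hqW, hqeq s ⟨hs.1, h1⟩, neg_sq, hf2]
              linarith
        _ = ENNReal.ofReal (∫ s in Ioc l (S + l), 2 * f (φ (S + l - s)) ^ 2) := by
            rw [ofReal_integral_eq_lintegral_ofReal]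
            · exact (hg.integrableOn_Icc).mono_set Ioc_subset_Icc_self
            · exact .of_forall fun s => by positivity
        _ ≤ _ := by
            refine ENNReal.ofReal_le_ofReal ?_
            rw [← intervalIntegral.integral_of_le (by linarith)]
            set Ψ : ℝ → ℝ := fun t => ∫ s in (0 : ℝ)..t, f s
            have hΨ : ∀ t, HasDerivAt Ψ (f t) t := fun t =>
              intervalIntegral.integral_hasDerivAt_right (hfc.intervalIntegrable _ _)
                hfc.stronglyMeasurable.stronglyMeasurableAtFilter hfc.continuousAt
            have hd : ∀ s, HasDerivAt (fun s => -2 * Ψ (φ (S + l - s)))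
                (2 * f (φ (S + l - s)) ^ 2) s := by
              intro s
              have := ((hΨ (φ (S + l - s))).comp s (hφd s)).const_mul (-2)
              refine this.congr_deriv ?_
              ring
            rw [intervalIntegral.integral_eq_sub_of_hasDerivAt (fun s _ => hd s)
              (hg.intervalIntegrable _ _)]
            simp only [sub_self, add_sub_cancel_right, hφ0, hS]
            have hΨ0 : Ψ 0 = 0 := by simp [Ψ]
            have hΨa : Ψ a ≤ Phi W a + η / 4 := by
              have hsq : Continuous fun s => √(F s) := by fun_prop
              calc Ψ a ≤ ∫ s in (0 : ℝ)..a, (√(F s) + √τ) := by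
                    refine intervalIntegral.integral_mono_on ha.le (hfc.intervalIntegrable _ _)
                      ((hsq.add continuous_const).intervalIntegrable _ _) fun s _ => ?_
                    refine Real.sqrt_le_iff.2 ⟨by positivity, ?_⟩
                    rw [add_sq, Real.sq_sqrt (hF0 s), Real.sq_sqrt hτ.le]
                    have : 0 ≤ 2 * √(F s) * √τ := by positivity
                    linarith
                _ = (∫ s in (0 : ℝ)..a, √(F s)) + a * √τ := by
                    rw [intervalIntegral.integral_add (hsq.intervalIntegrable _ _)
                      (continuous_const.intervalIntegrable _ _)]
                    simp
                _ = Phi W a + a * √τ := by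
                    congr 1
                    refine intervalIntegral.integral_congr fun s hs => ?_
                    rw [uIcc_of_le ha.le] at hs
                    simp only [hFW ⟨hs.1, hs.2.trans ha1⟩]
                _ ≤ _ := by
                    rw [hsτ]
                    nlinarith
            rw [hΨ0]
            linarith
    have hP0 : 0 ≤ Phi W a := intervalIntegral.integral_nonneg ha.le fun _ _ => Real.sqrt_nonneg _
    calc ∫⁻ s in Ioi 0, h s ≤ ∫⁻ s in (Ioc 0 l ∪ Ioc l (S + l)) ∪ Ioi (S + l), h s :=
          lintegral_mono_set hsub
      _ ≤ (∫⁻ s in Ioc 0 l, h s) + (∫⁻ s in Ioc l (S + l), h s) + ∫⁻ s in Ioi (S + l), h s :=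
          (lintegral_union_le _ _ _).trans (add_le_add_left (lintegral_union_le _ _ _) _)
      _ ≤ ENNReal.ofReal (η / 2) + ENNReal.ofReal (2 * Phi W a + η / 2) + 0 := by
          rw [e3]
          gcongr
      _ = _ := by
          rw [add_zero, ← ENNReal.ofReal_add (by positivity) (by positivity)]
          congr 1
          ring

end SoapFilm

/-! ### Integration along normal lines, and the chain rule for a Lipschitz inner function. -/

namespace SoapFilm

variable {n : ℕ}

section Splitting

variable {N : Space n}

lemma proj_add_inner_smul (hN : ‖N‖ = 1) (x : Space n) :
    ((ℝ ∙ N)ᗮ.orthogonalProjectionOnto x : Space n) + inner ℝ N x • N = x := by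
  have h1 := (ℝ ∙ N).starProjection_add_starProjection_orthogonal x
  rw [Submodule.starProjection_unit_singleton ℝ hN, add_comm] at h1
  exact h1

lemma proj_add_smul (hN : ‖N‖ = 1) (y : (ℝ ∙ N)ᗮ) (t : ℝ) :
    (ℝ ∙ N)ᗮ.orthogonalProjectionOnto ((y : Space n) + t • N) = y ∧
      inner ℝ N ((y : Space n) + t • N) = t := by
  have h2 : inner ℝ N (y : Space n) = 0 := Submodule.mem_orthogonal_singleton_iff_inner_right.1 y.2
  constructor
  · rw [map_add, map_smul, Submodule.orthogonalProjectionOnto_orthogonalComplement_singleton_eq_zero,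
      smul_zero, add_zero]
    exact Submodule.orthogonalProjectionOnto_mem_subspace_eq_self y
  · rw [inner_add_right, inner_smul_right, h2, real_inner_self_eq_norm_sq, hN]
    ring

lemma norm_le_norm_proj_add (hN : ‖N‖ = 1) (x : Space n) :
    ‖x‖ ≤ ‖(ℝ ∙ N)ᗮ.orthogonalProjectionOnto x‖ + |inner ℝ N x| := by
  conv_lhs => rw [← proj_add_inner_smul hN x]
  refine (norm_add_le _ _).trans ?_
  rw [norm_smul, hN, mul_one]
  exact le_rfl

lemma lintegral_eq_lintegral_lintegral_line (hN : ‖N‖ = 1) {F : Space n → ℝ≥0∞}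
    (hF : Measurable F) :
    ∫⁻ x, F x = ∫⁻ y : (ℝ ∙ N)ᗮ, ∫⁻ t : ℝ, F ((y : Space n) + t • N) := by
  set s : Submodule ℝ (Space n) := ℝ ∙ N
  have hmp := s.measurePreserving_measurableEquivProd (0 : Space n)
  rw [InnerProductSpace.euclideanHausdorffMeasure_eq_volume] at hmp
  have h1 : ∫⁻ x, F x = ∫⁻ p : s × sᗮ, F ((s.measurableEquivProd (0 : Space n)).symm p) := by
    rw [← hmp.lintegral_comp_emb (MeasurableEquiv.measurableEmbedding _)]
    simp
  rw [h1]
  simp only [Submodule.measurableEquivProd_symm_apply, vadd_eq_add, add_zero]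
  rw [Measure.volume_eq_prod, lintegral_prod_symm' _ (by fun_prop)]
  refine lintegral_congr fun y => ?_
  have h2 := (LinearIsometryEquiv.toSpanUnitSingleton (𝕜 := ℝ) N hN).measurePreserving
  rw [← h2.lintegral_comp (by fun_prop)]
  refine lintegral_congr fun t => ?_
  rw [add_comm]
  rfl

end Splitting

lemma lintegral_comp_abs_div {f : ℝ → ℝ≥0∞} (hf : Measurable f) {ε : ℝ} (hε : 0 < ε) (c : ℝ) :
    ∫⁻ t : ℝ, f (|t - c| / ε) = ENNReal.ofReal ε * (2 * ∫⁻ s in Ioi 0, f s) := by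
  have h1 : ∫⁻ t : ℝ, f (|t - c| / ε) = ∫⁻ t : ℝ, f (|t| / ε) :=
    lintegral_sub_right_eq_self (fun t => f (|t| / ε)) c
  have h2 : ∫⁻ t : ℝ, f (|t| / ε) = ENNReal.ofReal ε * ∫⁻ t : ℝ, f |t| := by
    have h3 : ∫⁻ t : ℝ, f (|t| / ε) = ∫⁻ t : ℝ, f |ε⁻¹ * t| := by
      refine lintegral_congr fun t => ?_
      rw [abs_mul, abs_of_pos (inv_pos.2 hε), div_eq_inv_mul]
    rw [h3, ← lintegral_map (f := fun s => f |s|) (g := fun t => ε⁻¹ * t) (by fun_prop)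
      (by fun_prop), Real.map_volume_mul_left (inv_pos.2 hε).ne', inv_inv, abs_of_pos hε,
      lintegral_smul_measure, smul_eq_mul]
  have h4 : ∫⁻ t : ℝ, f |t| = 2 * ∫⁻ s in Ioi 0, f s := by
    have h5 : ∫⁻ t in Ioi (0 : ℝ), f |t| = ∫⁻ s in Ioi 0, f s :=
      setLIntegral_congr_fun measurableSet_Ioi fun t ht => by rw [abs_of_pos ht]
    have h6 : ∫⁻ t in Iio (0 : ℝ), f |t| = ∫⁻ t in Ioi (0 : ℝ), f |t| := by
      have hp := Measure.measurePreserving_neg (volume : Measure ℝ)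
      have := hp.setLIntegral_comp_preimage (measurableSet_Ioi (a := (0 : ℝ)))
        (f := fun t => f |t|) (by fun_prop)
      rw [← this]
      simp
    rw [← lintegral_add_compl _ (measurableSet_Ioi (a := (0 : ℝ))), compl_Ioi,
      setLIntegral_congr Iio_ae_eq_Iic.symm, h6, h5, two_mul]
  rw [h1, h2, h4]

/-- No differentiability of `ρ` at `x` is assumed, so the chain rule is replaced by a bound on the
local Lipschitz quotient of the composition. -/
lemma norm_fderiv_comp_le {q : ℝ → ℝ} {ρ : Space n → ℝ} {K : ℝ≥0} {D : ℝ} {x : Space n}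
    (hq : HasDerivAt q D (ρ x)) (hρ : LipschitzWith K ρ) :
    ‖fderiv ℝ (fun y => q (ρ y)) x‖ ≤ |D| * K := by
  refine le_of_forall_pos_le_add fun e he => ?_
  obtain ⟨η, hη, hηe⟩ : ∃ η : ℝ, 0 < η ∧ η * K ≤ e := by
    refine ⟨e / (K + 1), by positivity, ?_⟩
    rw [div_mul_eq_mul_div, div_le_iff₀ (by positivity)]
    nlinarith [K.2]
  refine (norm_fderiv_le_of_lip' ℝ (C := (|D| + η) * K) (by positivity) ?_).trans (by linarith)
  have h1 : ∀ᶠ s in 𝓝 (ρ x), |q s - q (ρ x) - (s - ρ x) * D| ≤ η * |s - ρ x| := by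
    have := (hasDerivAt_iff_isLittleO.1 hq).def hη
    simpa [smul_eq_mul] using this
  filter_upwards [hρ.continuous.continuousAt.eventually h1] with y hy
  have h2 : |ρ y - ρ x| ≤ K * ‖y - x‖ := by
    simpa [Real.dist_eq, dist_eq_norm] using hρ.dist_le_mul y x
  have h3 : |q (ρ y) - q (ρ x)| ≤ (|D| + η) * |ρ y - ρ x| := by
    calc |q (ρ y) - q (ρ x)|
        = |(q (ρ y) - q (ρ x) - (ρ y - ρ x) * D) + (ρ y - ρ x) * D| := by congr 1; ring
      _ ≤ _ := abs_add_le _ _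
      _ ≤ η * |ρ y - ρ x| + |ρ y - ρ x| * |D| := by rw [abs_mul (ρ y - ρ x)]; gcongr
      _ = _ := by ring
  rw [Real.norm_eq_abs]
  calc _ ≤ (|D| + η) * |ρ y - ρ x| := h3
    _ ≤ (|D| + η) * (K * ‖y - x‖) := by gcongr
    _ = _ := by ring

/-- At the corners of `q`, where it takes the value `0` or `a`, the composition has a global
extremum and its `fderiv` vanishes. -/
lemma IsProfile.norm_fderiv_le {W : ℝ → ℝ} {a l T I : ℝ} {q : ℝ → ℝ}
    (hq : IsProfile W a l T I q) {ρ : Space n → ℝ} {K : ℝ≥0} (hρ : LipschitzWith K ρ)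
    (x : Space n) : ‖fderiv ℝ (fun y => q (ρ y)) x‖ ≤ |deriv q (ρ x)| * K := by
  rcases eq_or_lt_of_le (hq.mem (ρ x)).1 with h0 | h0
  · rw [IsLocalMin.fderiv_eq_zero (.of_forall fun y => by rw [← h0]; exact (hq.mem (ρ y)).1)]
    simpa using by positivity
  rcases eq_or_lt_of_le (hq.mem (ρ x)).2 with h1 | h1
  · rw [IsLocalMax.fderiv_eq_zero (.of_forall fun y => by rw [h1]; exact (hq.mem (ρ y)).2)]
    simpa using by positivity
  · exact norm_fderiv_comp_le (hq.diff _ h0 h1).hasDerivAt hρ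

lemma IsDoubleWell.measurable_comp {W : ℝ → ℝ} (hW : IsDoubleWell W) {X : Type*}
    [MeasurableSpace X] {u : X → ℝ} (hu : Measurable u) (h01 : ∀ x, u x ∈ Icc (0 : ℝ) 1) :
    Measurable fun x => W (u x) := by
  obtain ⟨F, hFc, -, -, hFW⟩ := hW.exists_extension
  have : (fun x => W (u x)) = F ∘ u := funext fun x => (hFW (h01 x)).symm
  rw [this]
  exact hFc.measurable.comp hu

lemma IsPhase.mem {u : Space n → ℝ} (hu : IsPhase u) (x : Space n) : u x ∈ Icc (0 : ℝ) 1 :=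
  ⟨hu.nonneg x, hu.le_one x⟩

lemma IsPhase.continuous {u : Space n → ℝ} (hu : IsPhase u) : Continuous u := by
  obtain ⟨C, hC⟩ := hu.lipschitz
  exact hC.continuous

lemma IsPhase.measurable_energyDensity {W : ℝ → ℝ} (hW : IsDoubleWell W) {u : Space n → ℝ}
    (hu : IsPhase u) (ε : ℝ) : Measurable (energyDensity W ε u) := by
  have h1 : Measurable fun x => W (u x) := hW.measurable_comp hu.continuous.measurable hu.mem
  have h2 : Measurable fun x => ‖fderiv ℝ u x‖ := (measurable_fderiv ℝ u).norm
  exact (((h2.pow_const 2).const_mul ε).add (h1.div_const ε)).ennreal_ofReal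

end SoapFilm

/-! ### The film over one compact, almost flat piece. -/

namespace SoapFilm

variable {n : ℕ}

/-- Bounding a chord by its projection plus its height and absorbing the height gives slope `σ / (1
- σ) ≤ 2 σ`. The height function on the projection is then extended as a real-valued Lipschitz
function. -/
lemma exists_graph_of_flat {N : Space n} (hN : ‖N‖ = 1) {σ : ℝ≥0} (hσ : σ ≤ 1 / 2)
    {S : Set (Space n)} (hS : ∀ x ∈ S, ∀ y ∈ S, |inner ℝ N (x - y)| ≤ σ * ‖x - y‖) :
    ∃ g : (ℝ ∙ N)ᗮ → ℝ, LipschitzWith (2 * σ) g ∧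
      ∀ x ∈ S, g ((ℝ ∙ N)ᗮ.orthogonalProjectionOnto x) = inner ℝ N x := by
  set P := (ℝ ∙ N)ᗮ.orthogonalProjectionOnto
  have hσ' : (σ : ℝ) ≤ 1 / 2 := by exact_mod_cast hσ
  have key : ∀ x ∈ S, ∀ y ∈ S, |inner ℝ N x - inner ℝ N y| ≤ 2 * σ * ‖P x - P y‖ := by
    intro x hx y hy
    have h1 := hS x hx y hy
    have h2 := norm_le_norm_proj_add hN (x - y)
    rw [map_sub] at h2
    rw [← inner_sub_right]
    have h3 : |inner ℝ N (x - y)| ≤ σ * (‖P x - P y‖ + |inner ℝ N (x - y)|) :=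
      h1.trans (by gcongr)
    nlinarith [abs_nonneg (inner ℝ N (x - y))]
  set g₀ : (ℝ ∙ N)ᗮ → ℝ := fun y => inner ℝ N (Function.invFunOn P S y)
  have hg₀ : ∀ x ∈ S, g₀ (P x) = inner ℝ N x := by
    intro x hx
    have hm : P x ∈ P '' S := mem_image_of_mem _ hx
    have h1 := key _ (Function.invFunOn_mem hm) x hx
    rw [Function.invFunOn_eq hm, sub_self, norm_zero, mul_zero] at h1
    exact sub_eq_zero.1 (abs_nonpos_iff.1 h1)
  have hL : LipschitzOnWith (2 * σ) g₀ (P '' S) := by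
    refine LipschitzOnWith.of_dist_le_mul ?_
    rintro _ ⟨x, hx, rfl⟩ _ ⟨y, hy, rfl⟩
    rw [hg₀ x hx, hg₀ y hy, Real.dist_eq, dist_eq_norm]
    exact key x hx y hy
  obtain ⟨g, hg, hgg⟩ := hL.extend_real
  exact ⟨g, hg, fun x hx => by rw [← hgg (mem_image_of_mem _ hx), hg₀ x hx]⟩

lemma volume_proj_image_le {N : Space n} (hN : ‖N‖ = 1) (S : Set (Space n)) :
    volume ((ℝ ∙ N)ᗮ.orthogonalProjectionOnto '' S) ≤ μHE[n] S := by
  have : Fact (Module.finrank ℝ (Space n) = n + 1) := ⟨by simp⟩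
  have hN0 : N ≠ 0 := by rintro rfl; simp at hN
  have hfin : Module.finrank ℝ (ℝ ∙ N)ᗮ = n := Submodule.finrank_orthogonal_span_singleton hN0
  rw [← InnerProductSpace.euclideanHausdorffMeasure_eq_volume, hfin]
  have := euclideanHausdorffMeasure_image_le
    ((ℝ ∙ N)ᗮ.lipschitzWith_orthogonalProjectionOnto.lipschitzOnWith (s := S)) n
  simpa using this

/-- Controls the lateral layer of the film, above points just outside the projection of the piece.
-/
lemma eventually_volume_cthickening_diff_le {H : Type*} [NormedAddCommGroup H]
    [InnerProductSpace ℝ H] [FiniteDimensional ℝ H] [MeasurableSpace H] [BorelSpace H]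
    {Y : Set H} (hY : IsCompact Y) (T : ℝ) {κ : ℝ≥0∞} (hκ : κ ≠ 0) :
    ∀ᶠ ε : ℝ in 𝓝[>] 0, volume (Metric.cthickening (ε * T) Y \ Y) ≤ κ := by
  have h1 : Tendsto (fun ε : ℝ => ε * T) (𝓝[>] 0) (𝓝 0) := by
    have : Continuous fun ε : ℝ => ε * T := by fun_prop
    simpa using (this.tendsto 0).mono_left (nhdsWithin_le_nhds (s := Ioi 0))
  have h2 := (tendsto_measure_cthickening_of_isCompact (μ := volume) hY).comp h1
  have h3 : ∀ᶠ ε : ℝ in 𝓝[>] 0, volume (Metric.cthickening (ε * T) Y) < volume Y + κ :=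
    h2.eventually_lt_const (ENNReal.lt_add_right hY.measure_lt_top.ne hκ)
  filter_upwards [h3] with ε hε
  rw [measure_sdiff (Metric.self_subset_cthickening _) hY.measurableSet.nullMeasurableSet
    hY.measure_lt_top.ne]
  exact tsub_le_iff_left.2 hε.le

/-- The energy density, as a function of the scaled signed distance, of a profile. -/
noncomputable def profileDensity (W q : ℝ → ℝ) (s : ℝ) : ℝ≥0∞ :=
  ENNReal.ofReal (deriv q s ^ 2 + W (q s))

namespace IsProfile

variable {W : ℝ → ℝ} {a l T I : ℝ} {q : ℝ → ℝ}

lemma measurable_profileDensity (hq : IsProfile W a l T I q) (hW : IsDoubleWell W) (ha : a ≤ 1) :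
    Measurable (profileDensity W q) := by
  obtain ⟨C, hC⟩ := hq.lipschitz
  have h1 : Measurable fun s => W (q s) := hW.measurable_comp hC.continuous.measurable
    fun s => ⟨(hq.mem s).1, (hq.mem s).2.trans ha⟩
  exact (((measurable_deriv q).pow_const 2).add h1).ennreal_ofReal

lemma exists_profileDensity_le (hq : IsProfile W a l T I q) (hW : IsDoubleWell W) (ha : a ≤ 1) :
    ∃ M : ℝ≥0, ∀ s, profileDensity W q s ≤ M := by
  obtain ⟨C, hC⟩ := hq.lipschitz
  obtain ⟨B, hB0, hB⟩ := hW.exists_bound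
  refine ⟨(C ^ 2 + B).toNNReal, fun s => ENNReal.ofReal_le_ofReal ?_⟩
  have h1 : ‖deriv q s‖ ≤ C := norm_deriv_le_of_lipschitz hC
  refine add_le_add ?_ (hB _ ⟨(hq.mem s).1, (hq.mem s).2.trans ha⟩)
  rw [← sq_abs]
  exact pow_le_pow_left₀ (abs_nonneg _) h1 2

lemma profileDensity_eq_zero (hq : IsProfile W a l T I q) (hW : IsDoubleWell W) {s : ℝ}
    (hs : T ≤ s) : profileDensity W q s = 0 := by
  have h0 := hq.bot s hs
  have h1 : deriv q s = 0 :=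
    IsLocalMin.deriv_eq_zero (.of_forall fun r => by rw [h0]; exact (hq.mem r).1)
  simp [profileDensity, h0, h1, hW.zero]

/-- The gradient term carries the factor `K²`; as `K ≥ 1`, the potential term can be given the same
factor. -/
lemma energyDensity_le (hq : IsProfile W a l T I q) (hW : IsDoubleWell W) (ha : a ≤ 1)
    {ρ : Space n → ℝ} {K : ℝ≥0} (hK : 1 ≤ K) (hρ : LipschitzWith K ρ) {ε : ℝ} (hε : 0 < ε)
    (x : Space n) :
    energyDensity W ε (fun y => q (ρ y / ε)) x
      ≤ ENNReal.ofReal (K ^ 2 / ε) * profileDensity W q (ρ x / ε) := by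
  have hρ' : LipschitzWith (K * ε.toNNReal⁻¹) fun y => ρ y / ε := by
    refine LipschitzWith.of_dist_le_mul fun y z => ?_
    have h1 := hρ.dist_le_mul y z
    rw [Real.dist_eq] at h1 ⊢
    rw [← sub_div, abs_div, abs_of_pos hε, NNReal.coe_mul, NNReal.coe_inv,
      Real.coe_toNNReal _ hε.le, div_le_iff₀ hε]
    calc _ ≤ _ := h1
      _ = _ := by field_simp
  have h1 := hq.norm_fderiv_le hρ' x
  rw [NNReal.coe_mul, NNReal.coe_inv, Real.coe_toNNReal _ hε.le] at h1
  have hW0 : 0 ≤ W (q (ρ x / ε)) := hW.nonneg ⟨(hq.mem _).1, (hq.mem _).2.trans ha⟩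
  have hK' : (1 : ℝ) ≤ K := by exact_mod_cast hK
  rw [profileDensity, ← ENNReal.ofReal_mul (by positivity), energyDensity]
  refine ENNReal.ofReal_le_ofReal ?_
  set D := deriv q (ρ x / ε)
  have h2 : ‖fderiv ℝ (fun y => q (ρ y / ε)) x‖ ^ 2 ≤ (|D| * (K * ε⁻¹)) ^ 2 :=
    pow_le_pow_left₀ (norm_nonneg _) h1 2
  calc ε * ‖fderiv ℝ (fun y => q (ρ y / ε)) x‖ ^ 2 + W (q (ρ x / ε)) / ε
      ≤ ε * (|D| * (K * ε⁻¹)) ^ 2 + K ^ 2 * (W (q (ρ x / ε)) / ε) := by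
        refine add_le_add (by gcongr) (le_mul_of_one_le_left (by positivity) ?_)
        nlinarith
    _ = K ^ 2 / ε * (D ^ 2 + W (q (ρ x / ε))) := by
        rw [mul_pow, sq_abs]
        field_simp

/-- A compact flat set is the core of a diffuse interface with almost optimal energy. -/
lemma eventually_exists_film (hq : IsProfile W a l T I q) (hW : IsDoubleWell W)
    (ha : a ≤ 1) (hl : 0 < l) (hT : 0 < T) {σ : ℝ≥0} (hσ : σ ≤ 1 / 2) {S : Set (Space n)}
    (hSc : IsCompact S) (hS : IsFlat σ S) {κ : ℝ≥0∞} (hκ : κ ≠ 0) :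
    ∀ᶠ ε : ℝ in 𝓝[>] 0, ∃ u : Space n → ℝ, IsPhase u ∧
      (∀ x, ∀ s ∈ S, dist x s ≤ ε * (l / 4) → u x = a) ∧
      (∀ x, u x ≠ 0 → ∃ s ∈ S, dist x s ≤ ε * (4 * T)) ∧
      ∫⁻ x, energyDensity W ε u x
        ≤ ENNReal.ofReal ((1 + 2 * σ) ^ 2) * (2 * ENNReal.ofReal I) * μHE[n] S + κ := by
  -- The distance `infDist` to the empty set is `0` by convention, so the empty piece needs its own,
  -- zero, film.
  rcases S.eq_empty_or_nonempty with rfl | hSne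
  · filter_upwards with ε
    refine ⟨fun _ => 0, IsPhase.zero, by simp, by simp, ?_⟩
    simp [energyDensity, hW.zero]
  obtain ⟨N, hN, hS⟩ := hS
  obtain ⟨g, hg, hgS⟩ := exists_graph_of_flat hN hσ hS
  obtain ⟨M, hM⟩ := hq.exists_profileDensity_le hW ha
  have hmeas := hq.measurable_profileDensity hW ha
  set P := (ℝ ∙ N)ᗮ.orthogonalProjectionOnto
  set Y : Set (ℝ ∙ N)ᗮ := P '' S
  have hYc : IsCompact Y := hSc.image P.continuous
  have hYne : Y.Nonempty := hSne.image _
  have hσ' : (σ : ℝ) ≤ 1 / 2 := by exact_mod_cast hσ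
  set K : ℝ≥0 := 1 + 2 * σ
  have hK1 : 1 ≤ K := le_self_add
  have hKreal : (K : ℝ) = 1 + 2 * σ := by simp [K]
  have hPL : LipschitzWith 1 P := (ℝ ∙ N)ᗮ.lipschitzWith_orthogonalProjectionOnto
  -- A substitute for the distance to `S`: over `Y` it is the vertical distance to the graph, so
  -- Fubini in direction `N` is exact there, and the second term cuts the film off away from `Y`.
  set ρ : Space n → ℝ := fun x => max |inner ℝ N x - g (P x)| (Metric.infDist (P x) Y)
  have hρL : LipschitzWith K ρ := by
    have h1 : LipschitzWith 1 fun x : Space n => inner ℝ N x :=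
      LipschitzWith.of_dist_le_mul fun x y => by
        rw [Real.dist_eq, ← inner_sub_right, dist_eq_norm, NNReal.coe_one, ← hN]
        exact abs_real_inner_le_norm _ _
    have h2 : LipschitzWith K fun x => |inner ℝ N x - g (P x)| := by
      have h3 := h1.sub (hg.comp hPL)
      rw [mul_one] at h3
      refine LipschitzWith.of_dist_le_mul fun x y => ?_
      refine le_trans ?_ (h3.dist_le_mul x y)
      exact abs_abs_sub_abs_le_abs_sub _ _
    have h4 : LipschitzWith K fun x => Metric.infDist (P x) Y := by
      have h5 := (Metric.lipschitz_infDist_pt Y).comp hPL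
      rw [mul_one] at h5
      exact h5.weaken hK1
    simpa using h2.max h4
  -- A bound, independent of `ε`, for the energy on any single line over the lateral layer: density
  -- at most `K² M / ε` on a segment of length `2 ε T`.
  set M' : ℝ≥0∞ := ENNReal.ofReal (K ^ 2) * M * ENNReal.ofReal (2 * T)
  have hM' : M' ≠ ⊤ := by finiteness
  have hκ' : κ / (M' + 1) ≠ 0 := (ENNReal.div_pos hκ (by finiteness)).ne'
  filter_upwards [eventually_volume_cthickening_diff_le hYc T hκ', self_mem_nhdsWithin]
    with ε hεY (hε : 0 < ε)
  obtain ⟨C, hC⟩ := hq.lipschitz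
  have hph : IsPhase fun x => q (ρ x / ε) := by
    refine ⟨⟨C * (ε.toNNReal⁻¹ * K), ?_⟩, fun x => (hq.mem _).1, fun x => (hq.mem _).2.trans ha⟩
    refine hC.comp (LipschitzWith.of_dist_le_mul fun y z => ?_)
    have h1 := hρL.dist_le_mul y z
    rw [Real.dist_eq] at h1 ⊢
    rw [← sub_div, abs_div, abs_of_pos hε, NNReal.coe_mul, NNReal.coe_inv,
      Real.coe_toNNReal _ hε.le, div_le_iff₀ hε]
    calc _ ≤ _ := h1
      _ = _ := by field_simp
  refine ⟨fun x => q (ρ x / ε), hph, fun x s hs hxs => ?_, fun x hx => ?_, ?_⟩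
  · refine hq.top _ ?_
    have h1 : ρ s = 0 := by
      have h2 : Metric.infDist (P s) Y = 0 := Metric.infDist_zero_of_mem (mem_image_of_mem _ hs)
      simp only [ρ, P, hgS s hs]
      simpa [P] using h2.le
    have h2 := hρL.dist_le_mul x s
    rw [Real.dist_eq, h1, sub_zero] at h2
    rw [div_le_iff₀ hε]
    calc ρ x ≤ |ρ x| := le_abs_self _
      _ ≤ K * dist x s := h2
      -- Since `σ ≤ 1/2`, the Lipschitz constant `1 + 2 σ` is at most `2`.
      _ ≤ 2 * (ε * (l / 4)) := by
          gcongr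
          rw [hKreal]
          linarith
      _ ≤ l * ε := by nlinarith [mul_pos hl hε]
  · have h1 : ρ x / ε < T := by
      by_contra h
      exact hx (hq.bot _ (not_lt.1 h))
    rw [div_lt_iff₀ hε] at h1
    obtain ⟨h2, h3⟩ := max_lt_iff.1 h1
    obtain ⟨_, ⟨s, hs, rfl⟩, hs2⟩ := hYc.exists_infDist_eq_dist hYne (P x)
    refine ⟨s, hs, ?_⟩
    rw [hs2, dist_eq_norm] at h3
    have h4 := hg.dist_le_mul (P x) (P s)
    have h5 : g (P s) = inner ℝ N s := hgS s hs
    rw [Real.dist_eq, dist_eq_norm, h5] at h4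
    push_cast at h4
    have h6 := norm_le_norm_proj_add hN (x - s)
    rw [map_sub, inner_sub_right] at h6
    rw [dist_eq_norm]
    have h7 : |inner ℝ N x - inner ℝ N s|
        ≤ |inner ℝ N x - g (P x)| + |g (P x) - inner ℝ N s| := abs_sub_le _ _ _
    have h8 : 2 * (σ : ℝ) * ‖P x - P s‖ ≤ 1 * ‖P x - P s‖ := by
      gcongr
      linarith
    have h9 : ‖x - s‖ ≤ ‖P x - P s‖ + |inner ℝ N x - inner ℝ N s| := h6
    -- The projected distance, the vertical distance to the graph and the variation of `g` are each
    -- at most `ε T`, so the total is within `4 ε T`.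
    nlinarith [mul_pos hT hε]
  · have hρm : Measurable fun x => ENNReal.ofReal (K ^ 2 / ε) * profileDensity W q (ρ x / ε) :=
      (hmeas.comp (hρL.continuous.measurable.div_const ε)).const_mul _
    have hpt : ∀ y : (ℝ ∙ N)ᗮ, ∀ t : ℝ,
        ρ ((y : Space n) + t • N) = max |t - g y| (Metric.infDist y Y) := by
      intro y t
      obtain ⟨h1, h2⟩ := proj_add_smul hN y t
      simp only [ρ, P, h1, h2]
    have hK2 : ENNReal.ofReal (K ^ 2 / ε) * ENNReal.ofReal ε = ENNReal.ofReal (K ^ 2) := by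
      rw [← ENNReal.ofReal_mul (by positivity), div_mul_cancel₀ _ hε.ne']
    have hinner : ∀ y : (ℝ ∙ N)ᗮ,
        ∫⁻ t : ℝ, ENNReal.ofReal (K ^ 2 / ε) * profileDensity W q (ρ ((y : Space n) + t • N) / ε)
          ≤ Y.indicator (fun _ => ENNReal.ofReal (K ^ 2) * (2 * ENNReal.ofReal I)) y
            + (Metric.cthickening (ε * T) Y \ Y).indicator (fun _ => M') y := by
      intro y
      simp only [hpt]
      rw [lintegral_const_mul _ (by fun_prop)]
      by_cases hy : y ∈ Y
      · refine le_add_right ?_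
        rw [indicator_of_mem hy]
        have h1 : ∀ t : ℝ, max |t - g y| (Metric.infDist y Y) = |t - g y| := fun t => by
          rw [Metric.infDist_zero_of_mem hy]
          exact max_eq_left (abs_nonneg _)
        simp only [h1]
        rw [lintegral_comp_abs_div hmeas hε, ← mul_assoc, hK2]
        gcongr
        exact hq.integral_le
      · refine le_add_left ?_
        by_cases hy2 : Metric.infDist y Y ≤ ε * T
        · have hmem : y ∈ Metric.cthickening (ε * T) Y \ Y := by
            refine ⟨?_, hy⟩
            rw [Metric.mem_cthickening_iff, ← ENNReal.ofReal_toReal (Metric.infEDist_ne_top hYne)]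
            exact ENNReal.ofReal_le_ofReal hy2
          rw [indicator_of_mem hmem]
          have h1 : ∀ t : ℝ, profileDensity W q (max |t - g y| (Metric.infDist y Y) / ε)
              ≤ (Metric.closedBall (g y) (ε * T)).indicator (fun _ => (M : ℝ≥0∞)) t := by
            intro t
            by_cases ht : t ∈ Metric.closedBall (g y) (ε * T)
            · rw [indicator_of_mem ht]
              exact hM _
            · rw [indicator_of_notMem ht, hq.profileDensity_eq_zero hW]
              rw [Metric.mem_closedBall, Real.dist_eq, not_le] at ht
              rw [le_div_iff₀ hε, mul_comm]
              exact ht.le.trans (le_max_left _ _)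
          calc _ ≤ ENNReal.ofReal (K ^ 2 / ε) *
                ∫⁻ t, (Metric.closedBall (g y) (ε * T)).indicator (fun _ => (M : ℝ≥0∞)) t := by
                gcongr with t
                exact h1 t
            _ = ENNReal.ofReal (K ^ 2 / ε) * (M * (ENNReal.ofReal ε * ENNReal.ofReal (2 * T))) := by
                rw [lintegral_indicator_const Metric.isClosed_closedBall.measurableSet,
                  Real.volume_closedBall, ← ENNReal.ofReal_mul hε.le]
                congr 3
                ring
            _ = (ENNReal.ofReal (K ^ 2 / ε) * ENNReal.ofReal ε) * M * ENNReal.ofReal (2 * T) := by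
                ring
            _ = M' := by rw [hK2]
        · have h1 : ∀ t : ℝ, profileDensity W q (max |t - g y| (Metric.infDist y Y) / ε) = 0 := by
            intro t
            refine hq.profileDensity_eq_zero hW ?_
            rw [le_div_iff₀ hε, mul_comm]
            exact (not_le.1 hy2).le.trans (le_max_right _ _)
          simp [h1]
    have hcm : MeasurableSet (Metric.cthickening (ε * T) Y \ Y) :=
      Metric.isClosed_cthickening.measurableSet.diff hYc.measurableSet
    calc ∫⁻ x, energyDensity W ε (fun x => q (ρ x / ε)) x
        ≤ ∫⁻ x, ENNReal.ofReal (K ^ 2 / ε) * profileDensity W q (ρ x / ε) :=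
          lintegral_mono fun x => hq.energyDensity_le hW ha hK1 hρL hε x
      _ = _ := lintegral_eq_lintegral_lintegral_line hN hρm
      _ ≤ _ := lintegral_mono hinner
      _ = ENNReal.ofReal (K ^ 2) * (2 * ENNReal.ofReal I) * volume Y
          + M' * volume (Metric.cthickening (ε * T) Y \ Y) := by
          rw [lintegral_add_left (measurable_const.indicator hYc.measurableSet),
            lintegral_indicator_const hYc.measurableSet, lintegral_indicator_const hcm]
      _ ≤ _ := by
          rw [hKreal]
          gcongr
          · exact volume_proj_image_le hN S
          · calc M' * volume (Metric.cthickening (ε * T) Y \ Y)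
                ≤ (M' + 1) * (κ / (M' + 1)) := by gcongr; exact le_self_add
              _ ≤ κ := ENNReal.mul_div_le

end IsProfile

end SoapFilm

/-! ### Covering estimates, decomposition of the film support, and joining films. -/

namespace SoapFilm

variable {n : ℕ}

/-- Vitali's lemma gives disjoint balls of radius `s` centred in `A` whose enlargements cover. Each
has measure at least `m`, so there are at most `μ univ / m` of them. -/
lemma volume_thickening_le {A : Set (Space n)} {μ : Measure (Space n)} {s r : ℝ} {m : ℝ≥0∞}
    (hs : 0 < s) (hm0 : m ≠ 0) (hmt : m ≠ ⊤) (hμ : ∀ x ∈ A, m ≤ μ (Metric.ball x s)) :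
    volume (Metric.thickening r A)
      ≤ volume (Metric.ball (0 : Space n) (r + 4 * s)) / m * μ univ := by
  obtain ⟨t, htA, htd, hcov⟩ := Vitali.exists_disjoint_subfamily_covering_enlargement_ball A id
    (fun _ => s) s (fun _ _ => le_rfl) 4 (by norm_num)
  simp only [id] at htd hcov
  have htc : t.Countable := htd.countable_of_isOpen (fun _ _ => Metric.isOpen_ball)
    fun x _ => Metric.nonempty_ball.2 hs
  have hsub : Metric.thickening r A ⊆ ⋃ b ∈ t, Metric.ball b (r + 4 * s) := by
    intro x hx
    obtain ⟨y, hy, hxy⟩ := Metric.mem_thickening_iff.1 hx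
    obtain ⟨b, hb, hyb⟩ := hcov y hy
    have h1 := hyb (Metric.mem_ball_self hs)
    rw [Metric.mem_ball] at h1
    refine mem_iUnion₂.2 ⟨b, hb, ?_⟩
    rw [Metric.mem_ball]
    linarith [dist_triangle x y b]
  set v := volume (Metric.ball (0 : Space n) (r + 4 * s))
  have : Countable t := htc
  calc volume (Metric.thickening r A) ≤ volume (⋃ b ∈ t, Metric.ball b (r + 4 * s)) :=
        measure_mono hsub
    _ ≤ ∑' b : t, volume (Metric.ball (b : Space n) (r + 4 * s)) := measure_biUnion_le _ htc _
    _ = ∑' _ : t, v / m * m := by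
        refine tsum_congr fun b => ?_
        rw [ENNReal.div_mul_cancel hm0 hmt, Measure.addHaar_ball_center]
    _ = v / m * ∑' _ : t, m := ENNReal.tsum_mul_left
    _ ≤ v / m * ∑' b : t, μ (Metric.ball (b : Space n) s) := by
        gcongr with b
        exact hμ b (htA b.2)
    _ = v / m * μ (⋃ b ∈ t, Metric.ball b s) := by
        rw [measure_biUnion htc htd fun _ _ => Metric.isOpen_ball.measurableSet]
    _ ≤ _ := by
        gcongr
        exact subset_univ _

/-- Scaling: each covering ball has volume of order `ε^(n+1)` and their number is of order `ε^(-n)`.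
The constant must not depend on `A` or `μ`, because it is fixed before the pieces of `K` are chosen.
-/
lemma exists_volume_thickening_le {c t r : ℝ} (hc : 0 < c) (ht : 0 < t) (hr : 0 < r) :
    ∃ D : ℝ, 0 ≤ D ∧ ∀ ε : ℝ, 0 < ε → ∀ (A : Set (Space n)) (μ : Measure (Space n)),
      (∀ x ∈ A, ENNReal.ofReal (c * (ε * t) ^ n) ≤ μ (Metric.ball x (ε * t))) →
      volume (Metric.thickening (ε * r) A) ≤ ENNReal.ofReal (D * ε) * μ univ := by
  set v₁ := (volume (Metric.ball (0 : Space n) 1)).toReal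
  refine ⟨(r + 4 * t) ^ (n + 1) * v₁ / (c * t ^ n), by positivity, fun ε hε A μ hμ => ?_⟩
  have hpos : 0 < c * (ε * t) ^ n := by positivity
  refine (volume_thickening_le (by positivity) (ENNReal.ofReal_pos.2 hpos).ne'
    ENNReal.ofReal_ne_top hμ).trans ?_
  gcongr
  rw [Measure.addHaar_ball _ _ (by positivity),
    ← ENNReal.ofReal_toReal (measure_ball_lt_top (μ := volume) (x := (0 : Space n)) (r := 1)).ne,
    ← ENNReal.ofReal_mul (by positivity), ← ENNReal.ofReal_div_of_pos hpos]
  refine ENNReal.ofReal_le_ofReal (le_of_eq ?_)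
  simp only [finrank_euclideanSpace, Fintype.card_fin]
  rw [show ε * r + 4 * (ε * t) = ε * (r + 4 * t) by ring, mul_pow, mul_pow]
  change ε ^ (n + 1) * (r + 4 * t) ^ (n + 1) * v₁ / _ = _
  field_simp
  ring

/-- Half of the error `m` pays for truncating the flat cover to finitely many sets, by continuity
from above. The other half pays for replacing the disjointed parts by compact subsets, by inner
regularity. -/
lemma exists_compact_flat_pieces {K : Set (Space n)} (hK : IsRectifiable n K)
    (hKm : MeasurableSet K) {σ : ℝ} (hσ : 0 < σ) {m : ℝ≥0∞} (hm : m ≠ 0) :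
    ∃ (k : ℕ) (S : ℕ → Set (Space n)), (∀ i, IsCompact (S i)) ∧ (∀ i, IsFlat σ (S i)) ∧
      (∀ i, S i ⊆ K) ∧ ∑ i ∈ Finset.range k, μHE[n] (S i) ≤ μHE[n] K ∧
      μHE[n] (K \ ⋃ i ∈ Finset.range k, S i) ≤ m := by
  obtain ⟨T, hTc, hTf, hT0⟩ := hK.exists_isFlat_cover hσ
  set μ := (μHE[n] : Measure (Space n)).restrict K
  have hμfin : IsFiniteMeasure μ := ⟨by simpa [μ] using hK.finite⟩
  have hm2 : m / 2 ≠ 0 := (ENNReal.half_pos hm).ne'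
  obtain ⟨k, hk⟩ : ∃ k : ℕ, μHE[n] (K \ ⋃ i ∈ Finset.range k, T i) ≤ m / 2 := by
    have hanti : Antitone fun k : ℕ => K \ ⋃ i ∈ Finset.range k, T i := by
      intro a b hab
      refine sdiff_subset_sdiff_right (biUnion_subset_biUnion_left ?_)
      exact Finset.range_subset_range.2 hab
    have hlim := tendsto_measure_iInter_atTop (μ := (μHE[n] : Measure (Space n)))
      (s := fun k : ℕ => K \ ⋃ i ∈ Finset.range k, T i)
      (fun k => (hKm.diff (Finset.measurableSet_biUnion _
        fun i _ => (hTc i).measurableSet)).nullMeasurableSet) hanti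
      ⟨0, ((measure_mono sdiff_subset).trans_lt hK.finite).ne⟩
    have hz : μHE[n] (⋂ k : ℕ, K \ ⋃ i ∈ Finset.range k, T i) = 0 := by
      refine measure_mono_null ?_ hT0
      intro x hx
      rw [mem_iInter] at hx
      refine ⟨(hx 0).1, fun h => ?_⟩
      obtain ⟨i, hi⟩ := mem_iUnion.1 h
      exact (hx (i + 1)).2 (mem_iUnion₂.2 ⟨i, by simp, hi⟩)
    rw [hz] at hlim
    obtain ⟨k, hk⟩ := (hlim.eventually_lt_const (pos_iff_ne_zero.2 hm2)).exists
    exact ⟨k, hk.le⟩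
  obtain ⟨e, he0, he⟩ := ENNReal.exists_pos_sum_of_countable hm2 ℕ
  have hdm : ∀ i, MeasurableSet (K ∩ disjointed T i) := fun i =>
    hKm.inter (MeasurableSet.disjointed (fun j => (hTc j).measurableSet) i)
  choose S hSD hSc hSm using fun i => (hdm i).exists_isCompact_sdiff_lt (μ := μ)
    (measure_ne_top _ _) (ENNReal.coe_ne_zero.2 (he0 i).ne')
  refine ⟨k, S, hSc, fun i => (hTf i).mono (((hSD i).trans inter_subset_right).trans
    (disjointed_subset _ _)), fun i => (hSD i).trans inter_subset_left, ?_, ?_⟩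
  · rw [← measure_biUnion_finset]
    · exact measure_mono (iUnion₂_subset fun i _ => (hSD i).trans inter_subset_left)
    · intro i _ j _ hij
      exact (disjoint_disjointed T hij).mono ((hSD i).trans inter_subset_right)
        ((hSD j).trans inter_subset_right)
    · exact fun i _ => (hSc i).measurableSet
  · have hsub : K \ ⋃ i ∈ Finset.range k, S i ⊆
        (K \ ⋃ i ∈ Finset.range k, T i) ∪ ⋃ i, ((K ∩ disjointed T i) \ S i) := by
      rintro x ⟨hxK, hx⟩
      by_cases hxT : x ∈ ⋃ i ∈ Finset.range k, T i
      · right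
        obtain ⟨j, hj, hxj⟩ := mem_iUnion₂.1 hxT
        classical
        have hex : ∃ i, x ∈ T i := ⟨j, hxj⟩
        have hlt : Nat.find hex < k :=
          (Nat.find_min' hex hxj).trans_lt (Finset.mem_range.1 hj)
        refine mem_iUnion.2 ⟨Nat.find hex, ⟨hxK, ?_⟩, fun h =>
          hx (mem_iUnion₂.2 ⟨_, Finset.mem_range.2 hlt, h⟩)⟩
        rw [disjointed_eq_inter_compl]
        exact ⟨Nat.find_spec hex, mem_iInter₂.2 fun i hi => Nat.find_min hex hi⟩
      · exact Or.inl ⟨hxK, hxT⟩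
    calc μHE[n] (K \ ⋃ i ∈ Finset.range k, S i)
        ≤ μHE[n] (K \ ⋃ i ∈ Finset.range k, T i) + μHE[n] (⋃ i, ((K ∩ disjointed T i) \ S i)) :=
          (measure_mono hsub).trans (measure_union_le _ _)
      _ ≤ m / 2 + ∑' i, (e i : ℝ≥0∞) := by
          refine add_le_add hk ((measure_iUnion_le _).trans (ENNReal.tsum_le_tsum fun i => ?_))
          refine le_trans (le_of_eq ?_) (hSm i).le
          rw [Measure.restrict_apply ((hdm i).diff (hSc i).measurableSet)]
          congr 1
          ext x
          simp only [Set.mem_sdiff, mem_inter_iff]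
          tauto
      _ ≤ m / 2 + m / 2 := by gcongr
      _ = m := ENNReal.add_halves m

/-- Where `u` is `0` or `1` it is extremal and sits in a well, so its density vanishes; elsewhere
the density is at most `ε · ε⁻² + B / ε`. -/
lemma lintegral_energyDensity_cutoff_le {W : ℝ → ℝ} (hW : IsDoubleWell W) {B : ℝ}
    (hB : ∀ t ∈ Icc (0 : ℝ) 1, W t ≤ B) {ε : ℝ} (hε : 0 < ε) {u : Space n → ℝ}
    (hu : LipschitzWith (ε.toNNReal)⁻¹ u) (hu01 : ∀ x, u x ∈ Icc (0 : ℝ) 1) {A : Set (Space n)}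
    (hA : ∀ x, x ∉ A → u x = 0 ∨ u x = 1) :
    ∫⁻ x, energyDensity W ε u x ≤ ENNReal.ofReal ((1 + B) / ε) * volume A := by
  refine le_trans (lintegral_mono fun x => ?_) (lintegral_indicator_const_le A _)
  by_cases hx : x ∈ A
  · rw [indicator_of_mem hx, energyDensity]
    refine ENNReal.ofReal_le_ofReal ?_
    have h1 : ‖fderiv ℝ u x‖ ≤ ε⁻¹ := by
      have := norm_fderiv_le_of_lipschitz ℝ hu (x₀ := x)
      rwa [NNReal.coe_inv, Real.coe_toNNReal _ hε.le] at this
    have h2 : ‖fderiv ℝ u x‖ ^ 2 ≤ (ε⁻¹) ^ 2 := pow_le_pow_left₀ (norm_nonneg _) h1 2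
    calc ε * ‖fderiv ℝ u x‖ ^ 2 + W (u x) / ε ≤ ε * (ε⁻¹) ^ 2 + B / ε := by
          gcongr
          exact hB _ (hu01 x)
      _ = (1 + B) / ε := by field_simp
  · rw [indicator_of_notMem hx, energyDensity]
    rcases hA x hx with h | h
    · rw [IsLocalMin.fderiv_eq_zero (.of_forall fun y => by rw [h]; exact (hu01 y).1), h, hW.zero]
      simp
    · rw [IsLocalMax.fderiv_eq_zero (.of_forall fun y => by rw [h]; exact (hu01 y).2), h, hW.one]
      simp

lemma exists_phase_sup {W : ℝ → ℝ} (hW : IsDoubleWell W) (ε : ℝ) {ι : Type*} (s : Finset ι)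
    (u : ι → Space n → ℝ) (hu : ∀ i ∈ s, IsPhase (u i)) :
    ∃ v : Space n → ℝ, IsPhase v ∧ (∀ i ∈ s, ∀ x, u i x ≤ v x) ∧
      (∀ x, v x ≠ 0 → ∃ i ∈ s, u i x ≠ 0) ∧
      ∫⁻ x, energyDensity W ε v x ≤ ∑ i ∈ s, ∫⁻ x, energyDensity W ε (u i) x := by
  classical
  induction s using Finset.induction_on with
  | empty =>
    refine ⟨fun _ => 0, IsPhase.zero, by simp, by simp, ?_⟩
    simp [energyDensity, hW.zero]
  | insert i s his ih =>
    obtain ⟨v, hv, hle, hne, hE⟩ := ih fun j hj => hu j (Finset.mem_insert_of_mem hj)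
    have hui := hu i (Finset.mem_insert_self i s)
    refine ⟨fun x => max (u i x) (v x), hui.max hv, ?_, ?_, ?_⟩
    · intro j hj x
      rcases Finset.mem_insert.1 hj with rfl | hj
      · exact le_max_left _ _
      · exact (hle j hj x).trans (le_max_right _ _)
    · intro x hx
      by_cases h : u i x = 0
      · have hvx : v x ≠ 0 := by
          intro h0
          exact hx (by simp [h, h0])
        obtain ⟨j, hj, hjx⟩ := hne x hvx
        exact ⟨j, Finset.mem_insert_of_mem hj, hjx⟩
      · exact ⟨i, Finset.mem_insert_self i s, h⟩
    · rw [Finset.sum_insert his]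
      exact (lintegral_energyDensity_max_le hui hv (hv.measurable_energyDensity hW ε)).trans
        (by gcongr)

end SoapFilm

/-! ### The film around the whole of `K`. -/

namespace SoapFilm

variable {n : ℕ}

/-- One `θ` serves both as flatness of the pieces and as excess energy of the profile; the left side
tends to `4 p H` as `θ → 0`. -/
lemma exists_small_parameter (p H : ℝ) {κ : ℝ} (hκ : 0 < κ) :
    ∃ θ : ℝ≥0, 0 < θ ∧ θ ≤ 1 / 2 ∧
      (1 + 2 * (θ : ℝ)) ^ 2 * (2 * (2 * p + θ)) * H ≤ 4 * p * H + κ := by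
  have hc : Continuous fun θ : ℝ => (1 + 2 * θ) ^ 2 * (2 * (2 * p + θ)) * H := by fun_prop
  have h1 : Tendsto (fun θ : ℝ => (1 + 2 * θ) ^ 2 * (2 * (2 * p + θ)) * H) (𝓝[>] 0)
      (𝓝 (4 * p * H)) := by
    have := (hc.tendsto 0).mono_left (nhdsWithin_le_nhds (s := Ioi 0))
    convert this using 2
    ring
  have h2 : ∀ᶠ θ : ℝ in 𝓝[>] 0, θ < 1 / 2 :=
    (eventually_lt_nhds (by norm_num)).filter_mono nhdsWithin_le_nhds
  obtain ⟨θ, ⟨h3, h4⟩, h5⟩ := ((h1.eventually_le_const (lt_add_of_pos_right _ hκ)).and h2).and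
    self_mem_nhdsWithin |>.exists
  have h5 : 0 < θ := h5
  lift θ to ℝ≥0 using h5.le
  exact ⟨θ, by exact_mod_cast h5, by exact_mod_cast h4.le, h3⟩

/-- Diffuse films concentrated near `K`, with energy close to that of two optimal transitions. -/
lemma exists_film {W : ℝ → ℝ} (hW : IsDoubleWell W) {K : Set (Space n)} (hK : IsRectifiable n K)
    (hKm : MeasurableSet K) {c r₀ : ℝ} (hc : 0 < c) (hr₀ : 0 < r₀)
    (hdens : ∀ x ∈ K, ∀ r : ℝ, 0 < r → r < r₀ →
      ENNReal.ofReal (c * r ^ n) ≤ μHE[n] (K ∩ Metric.ball x r))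
    {a : ℝ} (ha0 : 0 < a) (ha : a ≤ 1) {κ : ℝ} (hκ : 0 < κ) :
    ∃ C : ℝ, 0 ≤ C ∧ ∀ᶠ ε : ℝ in 𝓝[>] 0, ∃ u : Space n → ℝ, IsPhase u ∧ (∀ x ∈ K, a ≤ u x) ∧
      volume {x | u x ≠ 0} ≤ ENNReal.ofReal (C * ε) ∧
      ∫⁻ x, energyDensity W ε u x
        ≤ ENNReal.ofReal (4 * Phi W a) * μHE[n] K + ENNReal.ofReal κ := by
  set H := (μHE[n] K).toReal
  have hH : μHE[n] K = ENNReal.ofReal H := (ENNReal.ofReal_toReal hK.finite.ne).symm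
  have hH0 : 0 ≤ H := ENNReal.toReal_nonneg
  have hP0 : 0 ≤ Phi W a := intervalIntegral.integral_nonneg ha0.le fun _ _ => Real.sqrt_nonneg _
  obtain ⟨B, hB0, hB⟩ := hW.exists_bound
  obtain ⟨θ, hθ0, hθ2, hθ⟩ := exists_small_parameter (Phi W a) H (show 0 < κ / 3 by positivity)
  have hθ0' : (0 : ℝ) < θ := hθ0
  obtain ⟨l, T, q, hl, hlT, hq⟩ := exists_isProfile hW ha0 ha hθ0'
  have hT : 0 < T := hl.trans hlT
  -- `D` concerns the uncovered part, at the scale `ε l / 4` on which the films are constant; `D'`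
  -- concerns the support of the whole film.
  obtain ⟨D, hD0, hD⟩ := exists_volume_thickening_le (n := n) hc (show 0 < l / 4 by positivity)
    one_pos
  obtain ⟨D', hD'0, hD'⟩ := exists_volume_thickening_le (n := n) hc one_pos
    (show 0 < 4 * T + 1 by positivity)
  -- The leftover measure is chosen after `D`, so that the cutoff energy `(1 + B) D m` is at most `κ
  -- / 3`. The `+ 1` avoids division by zero.
  set m : ℝ := κ / 3 / ((1 + B) * D + 1)
  have hm : 0 < m := by positivity
  have hmκ : (1 + B) * D * m ≤ κ / 3 := by
    simp only [m]
    rw [mul_div_assoc', div_le_iff₀ (by positivity)]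
    nlinarith
  obtain ⟨k, S, hSc, hSf, hSK, hSsum, hSrem⟩ := exists_compact_flat_pieces hK hKm hθ0'
    (ENNReal.ofReal_pos.2 hm).ne'
  refine ⟨D' * H, by positivity, ?_⟩
  -- The error `κ / 3` is shared among the `k` pieces, with `k + 1` to allow `k = 0`.
  have hκk : ENNReal.ofReal (κ / 3) / (k + 1 : ℕ) ≠ 0 :=
    (ENNReal.div_pos (ENNReal.ofReal_pos.2 (by positivity)).ne' (ENNReal.natCast_ne_top _)).ne'
  have hpieces := (Filter.eventually_all_finset (Finset.range k)).2 fun i (_ : i ∈ Finset.range k) =>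
    hq.eventually_exists_film (n := n) hW ha hl hT hθ2 (hSc i) (hSf i) hκk
  have hsmall : ∀ b : ℝ, 0 < b → ∀ᶠ ε : ℝ in 𝓝[>] 0, ε * b < r₀ := fun b _ => by
    have h1 : Continuous fun ε : ℝ => ε * b := by fun_prop
    have h2 := (h1.tendsto 0).mono_left (nhdsWithin_le_nhds (s := Ioi 0))
    rw [zero_mul] at h2
    exact h2.eventually_lt_const hr₀
  filter_upwards [hpieces, hsmall (l / 4) (by positivity), hsmall 1 one_pos, self_mem_nhdsWithin]
    with ε hpieces hε1 hε2 (hε : 0 < ε)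
  choose! u hu huS husupp huE using hpieces
  obtain ⟨v, hv, hle, hvne, hvE⟩ := exists_phase_sup hW ε (Finset.range k) u hu
  -- Around a point of `R`, the ball of radius `ε l / 4` misses every piece. The density bound there
  -- is thus already satisfied by `ℋⁿ` restricted to the leftover `Q`, whose measure is at most `m`.
  set R : Set (Space n) := {x ∈ K | ∀ i ∈ Finset.range k, ∀ s ∈ S i, ε * (l / 4) < dist x s}
  set w : Space n → ℝ := fun x => (thickenedIndicator hε R x : ℝ)
  have hwL : LipschitzWith (ε.toNNReal)⁻¹ w := lipschitzWith_thickenedIndicator hε R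
  have hw01 : ∀ x, w x ∈ Icc (0 : ℝ) 1 := fun x =>
    ⟨NNReal.coe_nonneg _, by exact_mod_cast thickenedIndicator_le_one hε R x⟩
  have hw0 : ∀ x, x ∉ Metric.thickening ε R → w x = 0 := fun x hx => by
    simp only [w, thickenedIndicator_zero hε R hx, NNReal.coe_zero]
  have hwph : IsPhase w := ⟨⟨_, hwL⟩, fun x => (hw01 x).1, fun x => (hw01 x).2⟩
  refine ⟨fun x => max (v x) (w x), hv.max hwph, fun x hx => ?_, ?_, ?_⟩
  · by_cases hxR : x ∈ R
    · refine le_max_of_le_right ?_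
      simp only [w, thickenedIndicator_one hε R hxR, NNReal.coe_one]
      exact ha
    · have : ∃ i ∈ Finset.range k, ∃ s ∈ S i, dist x s ≤ ε * (l / 4) := by
        by_contra! hcon
        exact hxR ⟨hx, hcon⟩
      obtain ⟨i, hi, s, hs, hxs⟩ := this
      exact le_max_of_le_left ((huS i hi x s hs hxs).symm.le.trans (hle i hi x))
  · have hsub : {x | max (v x) (w x) ≠ 0} ⊆ Metric.thickening (ε * (4 * T + 1)) K := by
      intro x hx
      rw [Metric.mem_thickening_iff]
      by_cases hvx : v x = 0
      · have hwx : w x ≠ 0 := fun h => hx (by simp [hvx, h])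
        have hxt : x ∈ Metric.thickening ε R := by
          by_contra h
          exact hwx (hw0 x h)
        obtain ⟨z, hz, hxz⟩ := Metric.mem_thickening_iff.1 hxt
        exact ⟨z, hz.1, hxz.trans_le (by nlinarith [mul_pos hε hT])⟩
      · obtain ⟨i, hi, hix⟩ := hvne x hvx
        obtain ⟨s, hs, hxs⟩ := husupp i hi x hix
        exact ⟨s, hSK i hs, by linarith⟩
    refine (measure_mono hsub).trans ?_
    refine (hD' ε hε K (μHE[n].restrict K) fun x hx => ?_).trans ?_
    · rw [Measure.restrict_apply Metric.isOpen_ball.measurableSet, inter_comm]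
      exact hdens x hx _ (by positivity) hε2
    · rw [Measure.restrict_apply_univ, hH, ← ENNReal.ofReal_mul (by positivity)]
      exact ENNReal.ofReal_le_ofReal (le_of_eq (by ring))
  · set Q : Set (Space n) := K \ ⋃ i ∈ Finset.range k, S i
    have hwE : ∫⁻ x, energyDensity W ε w x ≤ ENNReal.ofReal (κ / 3) := by
      have h1 := lintegral_energyDensity_cutoff_le hW hB hε hwL hw01
        (A := Metric.thickening ε R) fun x hx => Or.inl (hw0 x hx)
      have h2 := hD ε hε R (μHE[n].restrict Q) fun x hx => by
        rw [Measure.restrict_apply Metric.isOpen_ball.measurableSet]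
        refine (hdens x hx.1 _ (by positivity) hε1).trans (measure_mono ?_)
        rintro z ⟨hzK, hz⟩
        refine ⟨hz, hzK, fun hzS => ?_⟩
        obtain ⟨i, hi, hzi⟩ := mem_iUnion₂.1 hzS
        have h3 := hx.2 i hi z hzi
        rw [Metric.mem_ball, dist_comm] at hz
        linarith
      rw [mul_one, Measure.restrict_apply_univ] at h2
      calc _ ≤ ENNReal.ofReal ((1 + B) / ε) * volume (Metric.thickening ε R) := h1
        _ ≤ ENNReal.ofReal ((1 + B) / ε) * (ENNReal.ofReal (D * ε) * ENNReal.ofReal m) := by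
            gcongr
            exact h2.trans (by gcongr)
        _ = ENNReal.ofReal ((1 + B) * D * m) := by
            rw [← ENNReal.ofReal_mul (by positivity), ← ENNReal.ofReal_mul (by positivity)]
            congr 1
            field_simp
        _ ≤ _ := ENNReal.ofReal_le_ofReal hmκ
    have hvE' : ∫⁻ x, energyDensity W ε v x
        ≤ ENNReal.ofReal (4 * Phi W a) * μHE[n] K + ENNReal.ofReal (κ / 3)
          + ENNReal.ofReal (κ / 3) := by
      set A : ℝ≥0∞ := ENNReal.ofReal ((1 + 2 * (θ : ℝ)) ^ 2) *
        (2 * ENNReal.ofReal (2 * Phi W a + θ))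
      calc _ ≤ ∑ i ∈ Finset.range k, ∫⁻ x, energyDensity W ε (u i) x := hvE
        _ ≤ ∑ i ∈ Finset.range k,
            (A * μHE[n] (S i) + ENNReal.ofReal (κ / 3) / (k + 1 : ℕ)) :=
            Finset.sum_le_sum fun i hi => huE i hi
        _ = A * ∑ i ∈ Finset.range k, μHE[n] (S i)
            + k * (ENNReal.ofReal (κ / 3) / (k + 1 : ℕ)) := by
            rw [Finset.sum_add_distrib, ← Finset.mul_sum]
            simp
        _ ≤ A * μHE[n] K + (k + 1 : ℕ) * (ENNReal.ofReal (κ / 3) / (k + 1 : ℕ)) := by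
            gcongr
            omega
        _ ≤ A * μHE[n] K + ENNReal.ofReal (κ / 3) := by
            gcongr
            exact ENNReal.mul_div_le
        _ ≤ _ := by
            gcongr
            have h2 : (2 : ℝ≥0∞) = ENNReal.ofReal 2 := by simp
            simp only [A]
            rw [hH, h2, ← ENNReal.ofReal_mul (by positivity), ← ENNReal.ofReal_mul (by positivity),
              ← ENNReal.ofReal_mul (by positivity), ← ENNReal.ofReal_mul (by positivity),
              ← ENNReal.ofReal_add (by positivity) (by positivity)]
            exact ENNReal.ofReal_le_ofReal hθ
    calc _ ≤ _ := lintegral_energyDensity_max_le hv hwph (hwph.measurable_energyDensity hW ε)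
      _ ≤ _ := add_le_add hvE' hwE
      _ = _ := by
          rw [add_assoc, add_assoc, ← ENNReal.ofReal_add (by positivity) (by positivity),
            ← ENNReal.ofReal_add (by positivity) (by positivity)]
          congr 2
          ring

end SoapFilm

/-! ### The volume density and the volume-fixing bubble. -/

namespace SoapFilm

variable {n : ℕ}

section VolumeDensity

variable {W : ℝ → ℝ}

lemma phi_nonneg {t : ℝ} (ht : 0 ≤ t) : 0 ≤ Phi W t :=
  intervalIntegral.integral_nonneg ht fun _ _ => Real.sqrt_nonneg _

lemma IsDoubleWell.exists_phi_extension (hW : IsDoubleWell W) :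
    ∃ G : ℝ → ℝ, Continuous G ∧ EqOn G (Phi W) (Icc 0 1) ∧ MonotoneOn G (Icc 0 1) := by
  obtain ⟨F, hFc, -, -, hFW⟩ := hW.exists_extension
  have hsq : Continuous fun s => √(F s) := by fun_prop
  refine ⟨fun t => ∫ s in (0 : ℝ)..t, √(F s), ?_, fun t ht => ?_, fun s hs t ht hst => ?_⟩
  · exact intervalIntegral.continuous_primitive (fun a b => hsq.intervalIntegrable a b) 0
  · refine intervalIntegral.integral_congr fun s hs => ?_
    rw [uIcc_of_le ht.1] at hs
    simp only [hFW ⟨hs.1, hs.2.trans ht.2⟩]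
  · exact intervalIntegral.integral_mono_interval le_rfl hs.1 hst
      (.of_forall fun _ => Real.sqrt_nonneg _) (hsq.intervalIntegrable _ _)

lemma IsDoubleWell.continuousOn_phi (hW : IsDoubleWell W) : ContinuousOn (Phi W) (Icc 0 1) := by
  obtain ⟨G, hG, hGe, -⟩ := hW.exists_phi_extension
  exact hG.continuousOn.congr fun t ht => (hGe ht).symm

lemma IsDoubleWell.phi_le_one (hW : IsDoubleWell W) {t : ℝ} (ht : t ∈ Icc (0 : ℝ) 1) :
    Phi W t ≤ 1 := by
  obtain ⟨G, -, hGe, hGm⟩ := hW.exists_phi_extension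
  have h1 : Phi W 1 = 1 := hW.normalized
  have := hGm ht (right_mem_Icc.2 zero_le_one) ht.2
  rwa [hGe ht, hGe (right_mem_Icc.2 zero_le_one), h1] at this

lemma IsDoubleWell.continuousOn_volDensity (hW : IsDoubleWell W) (n : ℕ) :
    ContinuousOn (volDensity n W) (Icc 0 1) :=
  hW.continuousOn_phi.rpow_const fun _ _ => Or.inr (by positivity)

lemma IsDoubleWell.volDensity_mem (hW : IsDoubleWell W) (n : ℕ) {t : ℝ}
    (ht : t ∈ Icc (0 : ℝ) 1) : volDensity n W t ∈ Icc (0 : ℝ) 1 :=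
  ⟨Real.rpow_nonneg (phi_nonneg ht.1) _,
    Real.rpow_le_one (phi_nonneg ht.1) (hW.phi_le_one ht) (by positivity)⟩

lemma volDensity_zero (hn : 1 ≤ n) : volDensity n W 0 = 0 := by
  have : (0 : ℝ) < n := by exact_mod_cast hn
  rw [volDensity, Phi, intervalIntegral.integral_same, Real.zero_rpow (by positivity)]

lemma IsDoubleWell.volDensity_one (hW : IsDoubleWell W) (n : ℕ) : volDensity n W 1 = 1 := by
  have h1 : Phi W 1 = 1 := hW.normalized
  rw [volDensity, h1, Real.one_rpow]

end VolumeDensity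

/-- A cutoff equal to `1` on the ball of radius `r` and to `0` off the ball of radius `r + ε`. -/
noncomputable def bubble (x₀ : Space n) (ε r : ℝ) (x : Space n) : ℝ :=
  max 0 (min 1 (1 - (dist x x₀ - r) / ε))

section Bubble

variable {x₀ : Space n} {ε r : ℝ}

lemma bubble_mem (x : Space n) : bubble x₀ ε r x ∈ Icc (0 : ℝ) 1 :=
  ⟨le_max_left _ _, max_le zero_le_one (min_le_left _ _)⟩

lemma bubble_eq_one (hε : 0 < ε) {x : Space n} (hx : dist x x₀ ≤ r) : bubble x₀ ε r x = 1 := by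
  have : (dist x x₀ - r) / ε ≤ 0 := div_nonpos_of_nonpos_of_nonneg (by linarith) hε.le
  rw [bubble, min_eq_left (by linarith), max_eq_right zero_le_one]

lemma bubble_eq_zero (hε : 0 < ε) {x : Space n} (hx : r + ε ≤ dist x x₀) :
    bubble x₀ ε r x = 0 := by
  have : 1 ≤ (dist x x₀ - r) / ε := by rw [le_div_iff₀ hε]; linarith
  rw [bubble, min_eq_right (by linarith), max_eq_left (by linarith)]

lemma lipschitzWith_bubble (hε : 0 < ε) : LipschitzWith (ε.toNNReal)⁻¹ (bubble x₀ ε r) := by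
  have h1 : LipschitzWith (ε.toNNReal)⁻¹ fun x : Space n => 1 - (dist x x₀ - r) / ε := by
    refine LipschitzWith.of_dist_le_mul fun x y => ?_
    have h2 := abs_dist_sub_le x y x₀
    rw [Real.dist_eq, NNReal.coe_inv, Real.coe_toNNReal _ hε.le,
      show 1 - (dist x x₀ - r) / ε - (1 - (dist y x₀ - r) / ε)
        = -(ε⁻¹ * (dist x x₀ - dist y x₀)) by field_simp; ring, abs_neg, abs_mul,
      abs_of_pos (inv_pos.2 hε)]
    gcongr
  exact (h1.const_min 1).const_max 0

lemma isPhase_bubble (hε : 0 < ε) : IsPhase (bubble x₀ ε r) :=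
  ⟨⟨_, lipschitzWith_bubble hε⟩, fun x => (bubble_mem x).1, fun x => (bubble_mem x).2⟩

/-- Used to bound the volume of the transition shell of the bubble by its thickness times an area.
-/
lemma pow_succ_sub_pow_succ_le {a b : ℝ} (ha : 0 ≤ a) (hab : a ≤ b) (m : ℕ) :
    b ^ (m + 1) - a ^ (m + 1) ≤ (m + 1) * (b - a) * b ^ m := by
  induction m with
  | zero => simp
  | succ m ih =>
    have h1 : a ^ (m + 1) ≤ b ^ (m + 1) := pow_le_pow_left₀ ha hab _
    have h2 : b ^ (m + 2) - a ^ (m + 2)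
        = b * (b ^ (m + 1) - a ^ (m + 1)) + a ^ (m + 1) * (b - a) := by ring
    have h3 := mul_le_mul_of_nonneg_left ih (ha.trans hab)
    have h4 := mul_le_mul_of_nonneg_right h1 (sub_nonneg.2 hab)
    push_cast
    rw [show m + 1 + 1 = m + 2 from rfl, h2]
    calc _ ≤ b * ((m + 1) * (b - a) * b ^ m) + b ^ (m + 1) * (b - a) := add_le_add h3 h4
      _ = _ := by ring

lemma lintegral_energyDensity_bubble_le {W : ℝ → ℝ} (hW : IsDoubleWell W) {B : ℝ} (hB0 : 0 ≤ B)
    (hB : ∀ t ∈ Icc (0 : ℝ) 1, W t ≤ B) (hε : 0 < ε) (hr : 0 ≤ r) :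
    ∫⁻ x, energyDensity W ε (bubble x₀ ε r) x ≤ ENNReal.ofReal
      ((1 + B) * (volume (Metric.ball (0 : Space n) 1)).toReal * (n + 1) * (r + ε) ^ n) := by
  set v₁ := (volume (Metric.ball (0 : Space n) 1)).toReal
  have hv₁ : volume (Metric.ball (0 : Space n) 1) = ENNReal.ofReal v₁ :=
    (ENNReal.ofReal_toReal measure_ball_lt_top.ne).symm
  refine (lintegral_energyDensity_cutoff_le hW hB hε (lipschitzWith_bubble hε) bubble_mem
    (A := Metric.ball x₀ (r + ε) \ Metric.closedBall x₀ r) fun x hx => ?_).trans ?_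
  · by_cases h : dist x x₀ ≤ r
    · exact Or.inr (bubble_eq_one hε h)
    · refine Or.inl (bubble_eq_zero hε ?_)
      by_contra h'
      exact hx ⟨not_le.1 h', h⟩
  · rw [measure_sdiff (Metric.closedBall_subset_ball (by linarith))
      Metric.isClosed_closedBall.measurableSet.nullMeasurableSet measure_closedBall_lt_top.ne,
      Measure.addHaar_ball _ _ (by positivity), Measure.addHaar_closedBall _ _ hr, hv₁,
      ← ENNReal.ofReal_mul (by positivity), ← ENNReal.ofReal_mul (by positivity),
      ← ENNReal.ofReal_sub _ (by positivity), ← ENNReal.ofReal_mul (by positivity)]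
    refine ENNReal.ofReal_le_ofReal ?_
    simp only [finrank_euclideanSpace, Fintype.card_fin]
    have h1 := pow_succ_sub_pow_succ_le hr (show r ≤ r + ε by linarith) n
    rw [add_sub_cancel_left] at h1
    calc (1 + B) / ε * ((r + ε) ^ (n + 1) * v₁ - r ^ (n + 1) * v₁)
        = (1 + B) / ε * (((r + ε) ^ (n + 1) - r ^ (n + 1)) * v₁) := by ring
      _ ≤ (1 + B) / ε * (((n + 1) * ε * (r + ε) ^ n) * v₁) := by gcongr
      _ = _ := by field_simp

/-- A bubble of suitable radius adjusts the volume of a film to a prescribed value. -/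
lemma exists_bubble_diffVolume_eq (hn : 1 ≤ n) {W : ℝ → ℝ} (hW : IsDoubleWell W)
    {Ω : Set (Space n)} (hball : Metric.closedBall x₀ 1 ⊆ Ω)
    {u : Space n → ℝ} (hu : IsPhase u) {p ν : ℝ} (hp : 0 ≤ p)
    (hup : volume {x | u x ≠ 0} ≤ ENNReal.ofReal p) (hε : 0 < ε) (hε1 : ε ≤ 1)
    (hν : p + ε * (volume (Metric.ball (0 : Space n) 1)).toReal ≤ ν)
    (hν1 : ν ≤ (volume (Metric.ball (0 : Space n) 1)).toReal) :
    ∃ r, 0 ≤ r ∧ r ^ (n + 1) * (volume (Metric.ball (0 : Space n) 1)).toReal ≤ ν ∧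
      diffVolume W Ω (fun x => max (u x) (bubble x₀ ε r x)) = ENNReal.ofReal ν := by
  set v₁ := (volume (Metric.ball (0 : Space n) 1)).toReal
  have hv₁ : volume (Metric.ball (0 : Space n) 1) = ENNReal.ofReal v₁ :=
    (ENNReal.ofReal_toReal measure_ball_lt_top.ne).symm
  have hphase : ∀ r, IsPhase fun x => max (u x) (bubble x₀ ε r x) := fun r =>
    hu.max (isPhase_bubble hε)
  set V : ℝ → Space n → ℝ := fun r x => volDensity n W (max (u x) (bubble x₀ ε r x))
  have hV01 : ∀ r x, V r x ∈ Icc (0 : ℝ) 1 := fun r x => hW.volDensity_mem n ((hphase r).mem x)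
  have hVc : ∀ r, Continuous (V r) := fun r =>
    hW.continuousOn_volDensity n |>.comp_continuous (hphase r).continuous (hphase r).mem
  have hVcr : ∀ x, Continuous fun r => V r x := fun x => by
    refine (hW.continuousOn_volDensity n).comp_continuous ?_ fun r => (hphase r).mem x
    unfold bubble
    fun_prop
  set Z : ℝ → Set (Space n) := fun r => {x | u x ≠ 0} ∪ Metric.ball x₀ (r + ε)
  have hZm : ∀ r, MeasurableSet (Z r) := fun r =>
    (hu.continuous.measurable (measurableSet_singleton 0)).compl.union
      Metric.isOpen_ball.measurableSet
  have hVZ : ∀ r x, V r x ≤ (Z r).indicator (fun _ => (1 : ℝ)) x := by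
    intro r x
    by_cases hx : x ∈ Z r
    · rw [indicator_of_mem hx]
      exact (hV01 r x).2
    · rw [indicator_of_notMem hx]
      have h1 : u x = 0 := by
        by_contra h
        exact hx (Or.inl h)
      have h2 : bubble x₀ ε r x = 0 := bubble_eq_zero hε (not_lt.1 fun h => hx (Or.inr h))
      simp only [V, h1, h2, max_self, volDensity_zero hn, le_refl]
  have hZfin : ∀ r, volume (Z r) ≠ ⊤ := fun r =>
    ((measure_union_le _ _).trans_lt
      (ENNReal.add_lt_top.2 ⟨hup.trans_lt ENNReal.ofReal_lt_top, measure_ball_lt_top⟩)).ne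
  have hZi : ∀ r, Integrable ((Z r).indicator fun _ => (1 : ℝ)) (volume.restrict Ω) := fun r =>
    ((integrable_indicator_iff (hZm r)).2
      (integrableOn_const (hZfin r))).restrict
  have hVi : ∀ r, Integrable (V r) (volume.restrict Ω) := fun r =>
    (hZi r).mono' (hVc r).aestronglyMeasurable (.of_forall fun x => by
      rw [Real.norm_of_nonneg (hV01 r x).1]
      exact hVZ r x)
  set f : ℝ → ℝ := fun r => ∫ x in Ω, V r x
  have hfd : ∀ r, diffVolume W Ω (fun x => max (u x) (bubble x₀ ε r x)) = ENNReal.ofReal (f r) := by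
    intro r
    rw [ofReal_integral_eq_lintegral_ofReal (hVi r) (.of_forall fun x => (hV01 r x).1)]
    rfl
  have hfc : ContinuousOn f (Icc 0 1) := by
    refine continuousOn_of_dominated (bound := (Z 1).indicator fun _ => (1 : ℝ))
      (fun r _ => (hVc r).aestronglyMeasurable) (fun r hr => .of_forall fun x => ?_) (hZi 1)
      (.of_forall fun x => (hVcr x).continuousOn)
    rw [Real.norm_of_nonneg (hV01 r x).1]
    refine (hVZ r x).trans ?_
    refine indicator_le_indicator_of_subset ?_ (fun _ => zero_le_one) x
    exact union_subset_union_right _ (Metric.ball_subset_ball (by linarith [hr.2]))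
  have hlow : ∀ r, 0 ≤ r → r ≤ 1 → r ^ (n + 1) * v₁ ≤ f r := by
    intro r hr hr1
    have hsub : Metric.closedBall x₀ r ⊆ Ω := (Metric.closedBall_subset_closedBall hr1).trans hball
    have h1 : volume (Metric.closedBall x₀ r) ≤ ENNReal.ofReal (f r) := by
      rw [← hfd, diffVolume]
      calc volume (Metric.closedBall x₀ r) = ∫⁻ _ in Metric.closedBall x₀ r, 1 := by simp
        _ = ∫⁻ x in Metric.closedBall x₀ r, ENNReal.ofReal (V r x) := by
            refine setLIntegral_congr_fun Metric.isClosed_closedBall.measurableSet fun x hx => ?_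
            simp only [V, bubble_eq_one hε (Metric.mem_closedBall.1 hx),
              max_eq_right (hu.le_one x), hW.volDensity_one, ENNReal.ofReal_one]
        _ ≤ _ := lintegral_mono_set hsub
    rw [Measure.addHaar_closedBall _ _ hr, hv₁, ← ENNReal.ofReal_mul (by positivity)] at h1
    have h2 : 0 ≤ f r := integral_nonneg fun x => (hV01 r x).1
    simpa using (ENNReal.ofReal_le_ofReal_iff h2).1 h1
  -- At radius `0` the bubble lives in a ball of radius `ε`, of volume `ε^(n+1) v₁ ≤ ε v₁`.
  have hup0 : f 0 ≤ ν := by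
    have h1 : ENNReal.ofReal (f 0) ≤ ENNReal.ofReal (p + ε * v₁) := by
      rw [← hfd, diffVolume]
      calc _ ≤ ∫⁻ x, ENNReal.ofReal (V 0 x) := setLIntegral_le_lintegral _ _
        _ ≤ ∫⁻ x, (Z 0).indicator (fun _ => (1 : ℝ≥0∞)) x := by
            refine lintegral_mono fun x => ?_
            refine (ENNReal.ofReal_le_ofReal (hVZ 0 x)).trans (le_of_eq ?_)
            by_cases hx : x ∈ Z 0 <;> simp [hx]
        _ = volume (Z 0) := lintegral_indicator_one (hZm 0)
        _ ≤ ENNReal.ofReal p + ENNReal.ofReal (ε ^ (n + 1) * v₁) := by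
            refine (measure_union_le _ _).trans (add_le_add hup (le_of_eq ?_))
            rw [zero_add, Measure.addHaar_ball _ _ hε.le, hv₁, ← ENNReal.ofReal_mul (by positivity)]
            simp
        _ ≤ _ := by
            rw [← ENNReal.ofReal_add hp (by positivity)]
            refine ENNReal.ofReal_le_ofReal ?_
            gcongr
            exact pow_le_of_le_one hε.le hε1 (by omega)
    exact ((ENNReal.ofReal_le_ofReal_iff (by positivity)).1 h1).trans hν
  have hlow1 : ν ≤ f 1 := by
    have := hlow 1 zero_le_one le_rfl
    rw [one_pow, one_mul] at this
    exact hν1.trans this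
  -- The film and the bubble may overlap, since only continuity and the end values matter. The lower
  -- bound `hlow` at the radius found also shows that it is small when `ν` is.
  obtain ⟨r, hr, hfr⟩ := intermediate_value_Icc zero_le_one hfc ⟨hup0, hlow1⟩
  exact ⟨r, hr.1, hfr ▸ hlow r hr.1 hr.2, by rw [hfd, hfr]⟩

end Bubble

end SoapFilm

/-! ### Admissible competitors. -/

namespace SoapFilm

variable {n : ℕ}

lemma exists_closedBall_subset_compl {A : Set (Space n)} (hA : IsCompact A) :
    ∃ x₀ : Space n, Metric.closedBall x₀ 1 ⊆ Aᶜ := by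
  obtain ⟨M, hM⟩ := hA.isBounded.exists_norm_le
  obtain ⟨x₀, hx₀⟩ := NormedSpace.exists_lt_norm ℝ (Space n) (M + 1)
  refine ⟨x₀, fun x hx hxA => ?_⟩
  rw [Metric.mem_closedBall, dist_comm, dist_eq_norm] at hx
  have h1 := hM x hxA
  have h2 := norm_sub_norm_le x₀ x
  linarith

/-- Any `t > δ₀` eventually dominates `δ`, and truncating it at `1` is harmless because `δ < 1`.
This also covers `δ₀ = 1`. Continuity of `Φ` limits the loss. -/
lemma exists_level {W : ℝ → ℝ} (hW : IsDoubleWell W) {δ₀ : ℝ} (hδ₀ : δ₀ ∈ Icc (1 / 2 : ℝ) 1)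
    {δ : ℝ → ℝ} (hδ1 : ∀ ε ∈ Ioo (0 : ℝ) 1, δ ε < 1) (hδ : Tendsto δ (𝓝[>] 0) (𝓝 δ₀)) (H : ℝ)
    {κ : ℝ} (hκ : 0 < κ) :
    ∃ a, 0 < a ∧ a ≤ 1 ∧ (∀ᶠ ε in 𝓝[>] 0, δ ε ≤ a) ∧
      4 * Phi W a * H ≤ 4 * Phi W δ₀ * H + κ := by
  obtain ⟨G, hGc, hGe, -⟩ := hW.exists_phi_extension
  have hδ₀' : δ₀ ∈ Icc (0 : ℝ) 1 := ⟨by linarith [hδ₀.1], hδ₀.2⟩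
  have hc : Continuous fun t => 4 * G (min 1 t) * H := by fun_prop
  have h1 := (hc.tendsto δ₀).mono_left (nhdsWithin_le_nhds (s := Ioi δ₀))
  rw [min_eq_right hδ₀.2, hGe hδ₀'] at h1
  obtain ⟨t, ht, htδ⟩ := ((h1.eventually_le_const (lt_add_of_pos_right _ hκ)).and
    self_mem_nhdsWithin).exists
  have htδ : δ₀ < t := htδ
  have ht0 : 0 < t := hδ₀'.1.trans_lt htδ
  have hmem : min 1 t ∈ Icc (0 : ℝ) 1 := ⟨le_min zero_le_one ht0.le, min_le_left _ _⟩
  refine ⟨min 1 t, lt_min one_pos ht0, min_le_left _ _, ?_, ?_⟩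
  · filter_upwards [hδ.eventually_le_const htδ, Ioo_mem_nhdsGT one_pos] with ε h2 h3
    exact le_min (hδ1 ε h3).le h2
  · rwa [hGe hmem] at ht

/-- For small `ε`, admissible competitors with energy arbitrarily close to the bound exist. -/
lemma eventually_exists_competitor (hn : 1 ≤ n) {W : ℝ → ℝ} (hW : IsDoubleWell W)
    {wire Ω : Set (Space n)} (hwire : IsCompact wire) (hΩ : Ω = wireᶜ)
    {C : Set (Circle → Space n)} {K : Set (Space n)} (hKrect : IsRectifiable n K)
    (hKspan : IsSpanning Ω C K) {c r₀ : ℝ} (hc : 0 < c) (hr₀ : 0 < r₀)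
    (hdens : ∀ x ∈ K, ∀ r : ℝ, 0 < r → r < r₀ →
      ENNReal.ofReal (c * r ^ n) ≤ μHE[n] (K ∩ Metric.ball x r))
    {ν δ : ℝ → ℝ} {δ₀ : ℝ} (hνpos : ∀ ε ∈ Ioo (0 : ℝ) 1, 0 < ν ε)
    (hδ1 : ∀ ε ∈ Ioo (0 : ℝ) 1, δ ε < 1) (hν : Tendsto ν (𝓝[>] 0) (𝓝 0))
    (hδ₀ : δ₀ ∈ Icc (1 / 2 : ℝ) 1) (hδ : Tendsto δ (𝓝[>] 0) (𝓝 δ₀))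
    (hεν : Tendsto (fun ε => ε / ν ε) (𝓝[>] 0) (𝓝 0)) {κ : ℝ} (hκ : 0 < κ) :
    ∀ᶠ ε in 𝓝[>] 0, ∃ u : Space n → ℝ, IsPhase u ∧ IsSpanning Ω C {x ∈ Ω | δ ε ≤ u x} ∧
      diffVolume W Ω u = ENNReal.ofReal (ν ε) ∧
      allenCahn W ε Ω u / 2 ≤ ENNReal.ofReal (2 * Phi W δ₀) * μHE[n] K + ENNReal.ofReal κ := by
  have hΩo : IsOpen Ω := hΩ ▸ hwire.isClosed.isOpen_compl
  have hKm : MeasurableSet K := by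
    obtain ⟨F, hF, rfl⟩ := hKspan.1
    exact hF.measurableSet.inter hΩo.measurableSet
  have hKΩ : K ⊆ Ω := by
    obtain ⟨F, hF, rfl⟩ := hKspan.1
    exact inter_subset_right
  set H := (μHE[n] K).toReal
  have hH : μHE[n] K = ENNReal.ofReal H := (ENNReal.ofReal_toReal hKrect.finite.ne).symm
  have hH0 : 0 ≤ H := ENNReal.toReal_nonneg
  obtain ⟨B, hB0, hB⟩ := hW.exists_bound
  obtain ⟨x₀, hx₀⟩ := exists_closedBall_subset_compl hwire
  rw [← hΩ] at hx₀
  obtain ⟨a, ha0, ha1, hδa, haΦ⟩ := exists_level hW hδ₀ hδ1 hδ H (show 0 < κ / 3 by positivity)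
  obtain ⟨M, hM0, hM⟩ := exists_film hW hKrect hKm hc hr₀ hdens ha0 ha1
    (show 0 < κ / 3 by positivity)
  set v₁ := (volume (Metric.ball (0 : Space n) 1)).toReal
  have hv₁ : 0 < v₁ := ENNReal.toReal_pos (Metric.measure_ball_pos _ _ one_pos).ne'
    measure_ball_lt_top.ne
  -- `b` bounds both `r` and `ε`, so the bubble energy, of order `(r + ε)^n`, is at most `κ / 3`; `n
  -- ≥ 1` is essential here.
  obtain ⟨b, hb0, hb⟩ : ∃ b : ℝ, 0 < b ∧ (1 + B) * v₁ * (n + 1) * (2 * b) ^ n ≤ κ / 3 := by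
    have h1 : Continuous fun b : ℝ => (1 + B) * v₁ * (n + 1) * (2 * b) ^ n := by fun_prop
    have h2 := (h1.tendsto 0).mono_left (nhdsWithin_le_nhds (s := Ioi 0))
    simp only [mul_zero, zero_pow (show n ≠ 0 by omega)] at h2
    obtain ⟨b, h3, h4⟩ := ((h2.eventually_le_const (show 0 < κ / 3 by positivity)).and
      self_mem_nhdsWithin).exists
    exact ⟨b, h4, h3⟩
  filter_upwards [hM, hδa, Ioo_mem_nhdsGT one_pos, Ioo_mem_nhdsGT hb0,
    hν.eventually_le_const hv₁, hν.eventually_lt_const (show 0 < v₁ * b ^ (n + 1) by positivity),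
    hεν.eventually_le_const (show 0 < 1 / (M + v₁) by positivity)]
    with ε ⟨u, hu, huK, huvol, huE⟩ hδε hε hεb hν1 hνb hεν
  have hε0 : 0 < ε := hε.1
  -- The use of `ε / ν(ε) → 0`: the film and a bubble of radius zero together stay below the
  -- prescribed volume.
  have hvol : M * ε + ε * v₁ ≤ ν ε := by
    rw [div_le_div_iff₀ (hνpos ε hε) (by positivity)] at hεν
    linarith
  obtain ⟨r, hr0, hrν, hdiff⟩ := exists_bubble_diffVolume_eq hn hW hx₀ hu
    (show 0 ≤ M * ε by positivity) huvol hε0 hε.2.le hvol hν1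
  have hph := hu.max (isPhase_bubble (x₀ := x₀) (r := r) hε0)
  refine ⟨fun x => max (u x) (bubble x₀ ε r x), hph, ⟨?_, fun γ hγ => ?_⟩, hdiff, ?_⟩
  · refine ⟨{x | δ ε ≤ max (u x) (bubble x₀ ε r x)},
      isClosed_le continuous_const hph.continuous, ?_⟩
    ext x
    exact and_comm
  · obtain ⟨x, hxK, hxγ⟩ := hKspan.2 γ hγ
    exact ⟨x, ⟨hKΩ hxK, (hδε.trans (huK x hxK)).trans (le_max_left _ _)⟩, hxγ⟩
  · have hrb : r ≤ b := by
      by_contra h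
      have : b ^ (n + 1) ≤ r ^ (n + 1) := pow_le_pow_left₀ hb0.le (not_le.1 h).le _
      nlinarith
    have hbE : ∫⁻ x, energyDensity W ε (bubble x₀ ε r) x ≤ ENNReal.ofReal (κ / 3) := by
      refine (lintegral_energyDensity_bubble_le hW hB0.le hB hε0 hr0).trans
        (ENNReal.ofReal_le_ofReal (le_trans ?_ hb))
      gcongr
      linarith [hεb.2]
    obtain ⟨L, hL⟩ := hph.lipschitz
    have hΦa : 0 ≤ Phi W a := phi_nonneg ha0.le
    have hΦδ : 0 ≤ Phi W δ₀ := phi_nonneg (by linarith [hδ₀.1])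
    have hAC : allenCahn W ε Ω (fun x => max (u x) (bubble x₀ ε r x))
        ≤ ENNReal.ofReal (4 * Phi W δ₀ * H + κ) := by
      calc _ ≤ _ := allenCahn_le_lintegral hΩo hL
        _ ≤ _ := lintegral_energyDensity_max_le hu (isPhase_bubble hε0)
            ((isPhase_bubble hε0).measurable_energyDensity hW ε)
        _ ≤ _ := add_le_add huE hbE
        _ = ENNReal.ofReal (4 * Phi W a * H + κ / 3 + κ / 3) := by
            rw [hH, ← ENNReal.ofReal_mul (by positivity),
              ← ENNReal.ofReal_add (by positivity) (by positivity),
              ← ENNReal.ofReal_add (by positivity) (by positivity)]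
        _ ≤ _ := ENNReal.ofReal_le_ofReal (by linarith)
    calc _ ≤ ENNReal.ofReal (4 * Phi W δ₀ * H + κ) / 2 := by gcongr
      _ = ENNReal.ofReal ((4 * Phi W δ₀ * H + κ) / 2) := by
          rw [ENNReal.ofReal_div_of_pos two_pos]
          simp
      _ ≤ ENNReal.ofReal (2 * Phi W δ₀ * H + κ) := ENNReal.ofReal_le_ofReal (by linarith)
      _ = _ := by
          rw [hH, ← ENNReal.ofReal_mul (by positivity),
            ← ENNReal.ofReal_add (by positivity) (by positivity)]

end SoapFilm

/-! ### The theorem, with error `1 / (j + 1)` for the `j`-th family. -/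

theorem theorem4p3 (n : ℕ) (hn : 1 ≤ n) (W : ℝ → ℝ) (hW : SoapFilm.IsDoubleWell W)
    (wire Ω : Set (SoapFilm.Space n)) (hwire : IsCompact wire) (hΩ : Ω = wireᶜ)
    (hbdry : SoapFilm.HasSmoothBoundary Ω)
    (C : Set (Circle → SoapFilm.Space n)) (hC : SoapFilm.IsSpanningClass Ω C)
    (K : Set (SoapFilm.Space n)) (hKrect : SoapFilm.IsRectifiable n K)
    (hKbdd : Bornology.IsBounded K) (hKspan : SoapFilm.IsSpanning Ω C K)
    (hKdens : ∃ c r₀ : ℝ, 0 < c ∧ 0 < r₀ ∧ ∀ x ∈ closure K, ∀ r : ℝ, 0 < r → r < r₀ →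
      ENNReal.ofReal (c * r ^ n) ≤ μHE[n] (K ∩ Metric.ball x r))
    (ν δ : ℝ → ℝ) (δ₀ : ℝ)
    (hνpos : ∀ ε ∈ Ioo (0 : ℝ) 1, 0 < ν ε)
    (hδmem : ∀ ε ∈ Ioo (0 : ℝ) 1, δ ε ∈ Ioo (1 / 2 : ℝ) 1)
    (hν : Tendsto ν (𝓝[>] 0) (𝓝 0))
    (hδ₀ : δ₀ ∈ Icc (1 / 2 : ℝ) 1) (hδ : Tendsto δ (𝓝[>] 0) (𝓝 δ₀))
    (hεν : Tendsto (fun ε => ε / ν ε) (𝓝[>] 0) (𝓝 0)) :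
    ∃ (εs : ℕ → ℝ) (u : ℕ → ℝ → SoapFilm.Space n → ℝ),
      (∀ j, εs j ∈ Ioo (0 : ℝ) 1) ∧ Tendsto εs atTop (𝓝 0) ∧
      (∀ j, ∀ ε ∈ Ioo 0 (εs j),
        (∀ x ∈ Ω, u j ε x ∈ Icc (0 : ℝ) 1) ∧
        (∃ L : ℝ≥0, LipschitzOnWith L (u j ε) Ω) ∧
        SoapFilm.MemW12Loc Ω (u j ε) ∧
        SoapFilm.IsSpanning Ω C {x ∈ Ω | δ ε ≤ u j ε x} ∧
        SoapFilm.diffVolume W Ω (u j ε) = ENNReal.ofReal (ν ε)) ∧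
      limsup (fun j => ⨆ ε ∈ Ioo 0 (εs j), SoapFilm.allenCahn W ε Ω (u j ε) / 2) atTop
        ≤ ENNReal.ofReal (2 * SoapFilm.Phi W δ₀) * μHE[n] K := by
  obtain ⟨c, r₀, hc, hr₀, hdens⟩ := hKdens
  have key : ∀ j : ℕ, ∃ e ∈ Ioo (0 : ℝ) 1, e ≤ 1 / ((j : ℝ) + 1) ∧
      ∃ u : ℝ → SoapFilm.Space n → ℝ, ∀ ε ∈ Ioo 0 e, SoapFilm.IsPhase (u ε) ∧
        SoapFilm.IsSpanning Ω C {x ∈ Ω | δ ε ≤ u ε x} ∧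
        SoapFilm.diffVolume W Ω (u ε) = ENNReal.ofReal (ν ε) ∧
        SoapFilm.allenCahn W ε Ω (u ε) / 2 ≤ ENNReal.ofReal (2 * SoapFilm.Phi W δ₀) * μHE[n] K
          + ENNReal.ofReal (1 / ((j : ℝ) + 1)) := by
    intro j
    have hj : (0 : ℝ) < 1 / ((j : ℝ) + 1) := by positivity
    obtain ⟨e, he, hsub⟩ := mem_nhdsGT_iff_exists_Ioo_subset.1
      (SoapFilm.eventually_exists_competitor hn hW hwire hΩ hKrect hKspan hc hr₀
        (fun x hx => hdens x (subset_closure hx)) hνpos (fun ε hε => (hδmem ε hε).2) hν hδ₀ hδ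
        hεν hj)
    choose! u hu using fun ε (hε : ε ∈ Ioo 0 e) => hsub hε
    have he0 : 0 < e := he
    -- The term `1 / 2` keeps the threshold below `1` even for `j = 0`; the last term makes it tend
    -- to `0`.
    refine ⟨min e (min (1 / 2) (1 / ((j : ℝ) + 1))), ⟨by positivity, ?_⟩, ?_, u, fun ε hε => ?_⟩
    · exact ((min_le_right _ _).trans (min_le_left _ _)).trans_lt (by norm_num)
    · exact (min_le_right _ _).trans (min_le_right _ _)
    · exact hu ε ⟨hε.1, hε.2.trans_le (min_le_left _ _)⟩
  choose εs hεs hεj u hu using key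
  refine ⟨εs, u, hεs, ?_, fun j ε hε => ?_, ?_⟩
  · exact squeeze_zero (fun j => (hεs j).1.le) hεj tendsto_one_div_add_atTop_nhds_zero_nat
  · obtain ⟨h1, h2, h3, -⟩ := hu j ε hε
    obtain ⟨L, hL⟩ := h1.lipschitz
    exact ⟨fun x _ => h1.mem x, ⟨L, hL.lipschitzOnWith⟩, SoapFilm.memW12Loc_of_lipschitz hL, h2, h3⟩
  · have hlim : Tendsto (fun j : ℕ => ENNReal.ofReal (2 * SoapFilm.Phi W δ₀) * μHE[n] K
        + ENNReal.ofReal (1 / ((j : ℝ) + 1))) atTop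
        (𝓝 (ENNReal.ofReal (2 * SoapFilm.Phi W δ₀) * μHE[n] K)) := by
      have h1 := ENNReal.tendsto_ofReal tendsto_one_div_add_atTop_nhds_zero_nat
      rw [ENNReal.ofReal_zero] at h1
      simpa using h1.const_add (ENNReal.ofReal (2 * SoapFilm.Phi W δ₀) * μHE[n] K)
    calc _ ≤ limsup (fun j : ℕ => ENNReal.ofReal (2 * SoapFilm.Phi W δ₀) * μHE[n] K
          + ENNReal.ofReal (1 / ((j : ℝ) + 1))) atTop :=
          limsup_le_limsup (.of_forall fun j => iSup₂_le fun ε hε => (hu j ε hε).2.2.2)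
      _ = _ := hlim.limsup_eq
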